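/- For a finite point set $S\subset\mathbb{R}^2$, let $RCH(S)=\bigcap_{i=1}^{4}M_i(S)$ be its rectilinear convex hull, where $M_i(S)=\bigcup_{s\in S}\overline{Q_i(s)}$ and $Q_1(s),\dots,Q_4(s)$ are the four open axis-parallel quadrants with apex $s$. A finite point set is in general position if no two of its points share an $x$-coordinate or a $y$-coordinate. MaxRCH is the following problem: given a set $P$ of $n$ points in the plane in general position, find a subset $S\subseteq P$ for which the size of $RCH(S)$, that is, the number of points of $P$ on the boundary of $RCH(S)$, is maximum among all subsets of $P$. **Theorem.** MaxRCH can be solved in $O(n^3)$ time and $O(n^2)$ space. Precisely, there is one program (independent of $n$ and of the input) for a unit-cost random access machine that solves MaxRCH on every input of $n$ points in general position, listed in any order, within $T(n)=O(n^3)$ steps and using $M(n)=O(n^2)$ memory cells. Each memory cell holds a natural number smaller than $M(n)$, which is just enough to store an address; the machine has addition, truncated subtraction, multiplication and comparison of such numbers, and indirect addressing. The real coordinates of the points are a read-only input accessed by index, and the only operations on them are comparisons of two $x$-coordinates or of two $y$-coordinates. (In particular, the bounds hold on a real RAM.) -/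

import Mathlib

/-! ### Rectilinear convex hulls -/

/-- The open axis-aligned quadrants `Q₁(p), Q₂(p), Q₃(p), Q₄(p)` with apex `p`, numbered
counter-clockwise starting from the upper right one (`i = 0, 1, 2, 3` stands for
`1, 2, 3, 4`). -/
def quadrant (i : Fin 4) (p : ℝ × ℝ) : Set (ℝ × ℝ) :=
  match i with
  | 0 => Set.Ioi p.1 ×ˢ Set.Ioi p.2
  | 1 => Set.Iio p.1 ×ˢ Set.Ioi p.2
  | 2 => Set.Iio p.1 ×ˢ Set.Iio p.2
  | 3 => Set.Ioi p.1 ×ˢ Set.Iio p.2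

/-- `Mᵢ(S)`, the union of the closed quadrants `closure (Qᵢ(s))`, `s ∈ S`. -/
def quadrantUnion (i : Fin 4) (S : Set (ℝ × ℝ)) : Set (ℝ × ℝ) :=
  ⋃ s ∈ S, closure (quadrant i s)

/-- The rectilinear convex hull of `S`, the intersection of the four sets `Mᵢ(S)`. -/
def rch (S : Set (ℝ × ℝ)) : Set (ℝ × ℝ) :=
  ⋂ i : Fin 4, quadrantUnion i S

/-- The number of points of `P` on the boundary of the rectilinear convex hull of `S`. -/
noncomputable def boundaryCount (P S : Set (ℝ × ℝ)) : ℕ :=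
  (P ∩ frontier (rch S)).ncard

/-- The points of the (indexed) family are in general position: no two of them share the same
`x`-coordinate or the same `y`-coordinate. -/
def GeneralPosition {n : ℕ} (p : Fin n → ℝ × ℝ) : Prop :=
  Function.Injective (fun i => (p i).1) ∧ Function.Injective (fun i => (p i).2)

/-! Sanity check: for points in general position, the points of `P` on the boundary of
`rch S` are the points of `S` that are `i`-extremal for at least one `i`, that is, lie on the
boundary of `Mᵢ(S)`; so `boundaryCount` is also the number of extremal points. -/

theorem mem_quadrant_of_mem_closure (i : Fin 4) (s z : ℝ × ℝ) (h1 : z.1 ≠ s.1)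
    (h2 : z.2 ≠ s.2) (hz : z ∈ closure (quadrant i s)) : z ∈ quadrant i s := by
  fin_cases i <;>
    simp only [quadrant, closure_prod_eq, closure_Ioi, closure_Iio, Set.mem_prod, Set.mem_Ici,
      Set.mem_Iic, Set.mem_Ioi, Set.mem_Iio] at hz ⊢ <;>
    first
    | exact ⟨lt_of_le_of_ne hz.1 h1, lt_of_le_of_ne hz.2 h2⟩
    | exact ⟨lt_of_le_of_ne hz.1 h1.symm, lt_of_le_of_ne hz.2 h2⟩
    | exact ⟨lt_of_le_of_ne hz.1 h1, lt_of_le_of_ne hz.2 h2.symm⟩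
    | exact ⟨lt_of_le_of_ne hz.1 h1.symm, lt_of_le_of_ne hz.2 h2.symm⟩

theorem isOpen_quadrant (i : Fin 4) (s : ℝ × ℝ) : IsOpen (quadrant i s) := by
  fin_cases i
  · exact isOpen_Ioi.prod isOpen_Ioi
  · exact isOpen_Iio.prod isOpen_Ioi
  · exact isOpen_Iio.prod isOpen_Iio
  · exact isOpen_Ioi.prod isOpen_Iio

theorem self_mem_closure_quadrant (i : Fin 4) (s : ℝ × ℝ) : s ∈ closure (quadrant i s) := by
  fin_cases i <;> simp [quadrant, closure_prod_eq]

theorem inter_frontier_rch {n : ℕ} (p : Fin n → ℝ × ℝ) (hp : GeneralPosition p)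
    (S : Set (ℝ × ℝ)) (hS : S ⊆ Set.range p) :
    Set.range p ∩ frontier (rch S) = {s ∈ S | ∃ i, s ∈ frontier (quadrantUnion i S)} := by
  have hfin : S.Finite := (Set.finite_range p).subset hS
  have hcl : ∀ i, IsClosed (quadrantUnion i S) := fun i =>
    hfin.isClosed_biUnion fun s _ => isClosed_closure
  have hR : IsClosed (rch S) := isClosed_iInter hcl
  ext z
  constructor
  · rintro ⟨⟨j, rfl⟩, hz⟩
    rw [hR.frontier_eq, rch, interior_iInter_of_finite] at hz
    obtain ⟨hz1, hz2⟩ := hz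
    simp only [Set.mem_iInter, not_forall] at hz1 hz2
    obtain ⟨i, hi⟩ := hz2
    have hzi := hz1 i
    refine ⟨?_, i, ?_⟩
    · obtain ⟨s, hs, hzs⟩ := Set.mem_iUnion₂.1 hzi
      obtain ⟨k, rfl⟩ := hS hs
      by_cases hjk : j = k
      · rw [hjk]; exact hs
      · refine absurd ?_ hi
        refine interior_maximal ?_ (isOpen_quadrant i (p k))
          (mem_quadrant_of_mem_closure i (p k) (p j) (fun h => hjk (hp.1 h))
            (fun h => hjk (hp.2 h)) hzs)
        exact subset_closure.trans
          (Set.subset_biUnion_of_mem (u := fun s => closure (quadrant i s)) hs)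
    · rw [(hcl i).frontier_eq]; exact ⟨hzi, hi⟩
  · rintro ⟨hzS, i, hi⟩
    refine ⟨hS hzS, ?_⟩
    rw [hR.frontier_eq]
    refine ⟨Set.mem_iInter.2 fun j => Set.mem_biUnion hzS (self_mem_closure_quadrant j z), ?_⟩
    intro h
    rw [(hcl i).frontier_eq] at hi
    exact hi.2 (interior_mono (Set.iInter_subset _ i) h)

/-! ### The machine model

A unit-cost random access machine with `M` memory cells, addressed `0, …, M - 1`, each of which
holds a word, that is, a natural number smaller than `M`. The `2 n` real coordinates of the
`n` input points are in a read-only input that is accessed by index; the only operations on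
coordinates are comparisons of two `x`-coordinates or of two `y`-coordinates (so that everything
such a machine does can be done on a real RAM, which moreover has arithmetic on real numbers).

A program is a fixed piece of code: it does not depend on `n`, on `M` or on the input. -/

namespace RAM

/-- Arithmetic expressions; `cell e` is the content of the memory cell whose address is the value
of `e` (indirect addressing), `sub` is truncated subtraction. -/
inductive Expr : Type
  | const (k : ℕ) : Expr
  | cell (e : Expr) : Expr
  | add (e f : Expr) : Expr
  | sub (e f : Expr) : Expr
  | mul (e f : Expr) : Expr

/-- Tests; `xlt e f` compares the `x`-coordinates of the input points whose indices are the values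
of `e` and `f`, and `ylt e f` compares their `y`-coordinates. -/
inductive Test : Type
  | lt (e f : Expr) : Test
  | xlt (e f : Expr) : Test
  | ylt (e f : Expr) : Test
  | not (b : Test) : Test
  | and (b c : Test) : Test

/-- Programs; `assign a e` writes the value of `e` into the cell whose address is the value
of `a`. -/
inductive Prog : Type
  | skip : Prog
  | assign (a e : Expr) : Prog
  | seq (c d : Prog) : Prog
  | ite (b : Test) (c d : Prog) : Prog
  | loop (b : Test) (c : Prog) : Prog

/-- The value of an expression when the memory content is `m`. -/
def Expr.eval (m : ℕ → ℕ) : Expr → ℕ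
  | .const k => k
  | .cell e => m (e.eval m)
  | .add e f => e.eval m + f.eval m
  | .sub e f => e.eval m - f.eval m
  | .mul e f => e.eval m * f.eval m

/-- The expression can be evaluated by a machine with `M` cells: all values that occur, addresses
included, are words. -/
def Expr.Safe (M : ℕ) (m : ℕ → ℕ) : Expr → Prop
  | .const k => k < M
  | .cell e => e.Safe M m ∧ m (e.eval m) < M
  | .add e f => e.Safe M m ∧ f.Safe M m ∧ e.eval m + f.eval m < M
  | .sub e f => e.Safe M m ∧ f.Safe M m
  | .mul e f => e.Safe M m ∧ f.Safe M m ∧ e.eval m * f.eval m < M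

/-- The number of elementary operations in the evaluation of an expression. -/
def Expr.cost : Expr → ℕ
  | .const _ => 1
  | .cell e => e.cost + 1
  | .add e f => e.cost + f.cost + 1
  | .sub e f => e.cost + f.cost + 1
  | .mul e f => e.cost + f.cost + 1

/-- The truth value of a test when the input is `p` and the memory content is `m`. -/
def Test.eval {n : ℕ} (p : Fin n → ℝ × ℝ) (m : ℕ → ℕ) : Test → Prop
  | .lt e f => e.eval m < f.eval m
  | .xlt e f => ∃ (hi : e.eval m < n) (hj : f.eval m < n), (p ⟨_, hi⟩).1 < (p ⟨_, hj⟩).1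
  | .ylt e f => ∃ (hi : e.eval m < n) (hj : f.eval m < n), (p ⟨_, hi⟩).2 < (p ⟨_, hj⟩).2
  | .not b => ¬ b.eval p m
  | .and b c => b.eval p m ∧ c.eval p m

/-- The test can be evaluated by a machine with `M` cells on an input of `n` points. -/
def Test.Safe (n M : ℕ) (m : ℕ → ℕ) : Test → Prop
  | .lt e f => e.Safe M m ∧ f.Safe M m
  | .xlt e f => e.Safe M m ∧ f.Safe M m ∧ e.eval m < n ∧ f.eval m < n
  | .ylt e f => e.Safe M m ∧ f.Safe M m ∧ e.eval m < n ∧ f.eval m < n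
  | .not b => b.Safe n M m
  | .and b c => b.Safe n M m ∧ c.Safe n M m

/-- The number of elementary operations in the evaluation of a test. -/
def Test.cost : Test → ℕ
  | .lt e f => e.cost + f.cost + 1
  | .xlt e f => e.cost + f.cost + 1
  | .ylt e f => e.cost + f.cost + 1
  | .not b => b.cost + 1
  | .and b c => b.cost + c.cost + 1

/-- `Exec p M c m t m'`: on input `p`, a machine with `M` memory cells that runs `c` from the memory
content `m` halts after `t` steps with the memory content `m'`, without ever leaving its memory or
producing a number that is not a word. -/
inductive Exec {n : ℕ} (p : Fin n → ℝ × ℝ) (M : ℕ) :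
    Prog → (ℕ → ℕ) → ℕ → (ℕ → ℕ) → Prop
  | skip (m : ℕ → ℕ) : Exec p M .skip m 1 m
  | assign (a e : Expr) (m : ℕ → ℕ) (ha : a.Safe M m) (he : e.Safe M m) :
      Exec p M (.assign a e) m (a.cost + e.cost + 1) (Function.update m (a.eval m) (e.eval m))
  | seq {c d : Prog} {m m' m'' : ℕ → ℕ} {t u : ℕ} (hc : Exec p M c m t m')
      (hd : Exec p M d m' u m'') : Exec p M (.seq c d) m (t + u) m''
  | ite_true {b : Test} {c d : Prog} {m m' : ℕ → ℕ} {t : ℕ} (hs : b.Safe n M m)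
      (hb : b.eval p m) (hc : Exec p M c m t m') : Exec p M (.ite b c d) m (b.cost + t) m'
  | ite_false {b : Test} {c d : Prog} {m m' : ℕ → ℕ} {t : ℕ} (hs : b.Safe n M m)
      (hb : ¬ b.eval p m) (hd : Exec p M d m t m') : Exec p M (.ite b c d) m (b.cost + t) m'
  | loop_true {b : Test} {c : Prog} {m m' m'' : ℕ → ℕ} {t u : ℕ} (hs : b.Safe n M m)
      (hb : b.eval p m) (hc : Exec p M c m t m') (hl : Exec p M (.loop b c) m' u m'') :
      Exec p M (.loop b c) m (b.cost + t + u) m''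
  | loop_false {b : Test} {c : Prog} {m : ℕ → ℕ} (hs : b.Safe n M m)
      (hb : ¬ b.eval p m) : Exec p M (.loop b c) m b.cost m

/-- The initial memory: cell `0` holds the number `n` of input points, all other cells hold `0`. -/
def initMem (n : ℕ) : ℕ → ℕ :=
  Function.update (fun _ => 0) 0 n

/-- The subset of the input points that a halting machine outputs: cell `0` holds the address `a`
of an array of `n` cells, and the point with index `i` is in the subset if and only if the
cell `a + i` is not `0`. -/
def output {n : ℕ} (p : Fin n → ℝ × ℝ) (m : ℕ → ℕ) : Set (ℝ × ℝ) :=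
  p '' {i : Fin n | m (m 0 + i) ≠ 0}

/-- The program `c` solves the following problem in time `T` and space `M`, as functions of the
number `n` of input points: given `n` points in general position in the plane, find a subset `S`
of the set `P` of these points such that the number of points of `P` on the boundary of the
rectilinear convex hull of `S` is maximum among all subsets of `P`. -/
def Prog.SolvesMaxRCH (c : Prog) (T M : ℕ → ℕ) : Prop :=
  ∀ (n : ℕ) (p : Fin n → ℝ × ℝ), GeneralPosition p →
    ∃ (t : ℕ) (m : ℕ → ℕ), t ≤ T n ∧ Exec p (M n) c (initMem n) t m ∧ m 0 + n ≤ M n ∧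
      ∀ S : Set (ℝ × ℝ), S ⊆ Set.range p →
        boundaryCount (Set.range p) S ≤ boundaryCount (Set.range p) (output p m)

end RAM

/-! ### Extremal points -/

/-! A point of `S` is on the boundary of the hull exactly when one of the four open quadrants at it
contains no point of `S`. Read from left to right, such a point is a record: higher or lower than
everything to its left (early), or than everything to its right (late). Discarding the other points
of `S` keeps records records, so the optimum is the length of a longest sequence of labelled points
whose labels are respected pairwise (`exists_pairwise_length_eq`, `length_le_boundaryCount`).

Such sequences can be built remembering only two items. The items labelled `true` are first early
ones going up, then late ones going down, and those labelled `false` mirror this. Therefore the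
conditions between a new item and the whole past reduce to conditions on the last item of either
label (`ok_upd_iff`, `accepts_start_iff`).

This gives a dynamic program with `(2 n) ^ 2` states and at most `4 n` transitions from each, hence
cubic time and quadratic space. A transition always increases the number of the state (`num_upd`),
so the table can be filled from the highest number down. Its values bound all sequences from above
(`length_le_of_accepts`) and are attained by following the stored successors (`exists_trace`).
Everything else is a total correctness proof, in terms of `WP`, of a concrete program that sorts,
fills the table and walks along an optimal sequence. Addresses modulo 8 separate variables from
table columns, so most independence claims are linear arithmetic. -/

theorem mem_quadrant_trans (i : Fin 4) {s z t : ℝ × ℝ} (h : z ∈ closure (quadrant i s))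
    (h' : t ∈ quadrant i z) : t ∈ quadrant i s := by
  fin_cases i <;>
    simp only [quadrant, closure_prod_eq, closure_Ioi, closure_Iio, Set.mem_prod, Set.mem_Ici,
      Set.mem_Iic, Set.mem_Ioi, Set.mem_Iio] at h h' ⊢ <;>
    exact ⟨by linarith [h.1, h'.1], by linarith [h.2, h'.2]⟩

/-- The apexes whose open quadrant contains `s` form the opposite open quadrant at `s`, which has
`s` in its closure. This permits moving an interior point slightly towards the apexes. -/
theorem mem_closure_setOf_mem_quadrant (i : Fin 4) (s : ℝ × ℝ) :
    s ∈ closure {z | s ∈ quadrant i z} := by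
  have h : {z | s ∈ quadrant i z} = quadrant (i + 2) s := by
    ext z
    fin_cases i <;> simp [quadrant]
  rw [h]
  exact self_mem_closure_quadrant _ s

/-- A point of `S` lies on the boundary of `Mᵢ(S)` if and only if it lies in none of the open
quadrants whose closures make up `Mᵢ(S)`. -/
theorem mem_frontier_quadrantUnion_iff (i : Fin 4) {S : Set (ℝ × ℝ)} {s : ℝ × ℝ} (hs : s ∈ S) :
    s ∈ frontier (quadrantUnion i S) ↔ ∀ t ∈ S, s ∉ quadrant i t := by
  constructor
  · intro h t ht hst
    refine h.2 (interior_maximal ?_ (isOpen_quadrant i t) hst)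
    exact subset_closure.trans (Set.subset_biUnion_of_mem (u := fun s => closure (quadrant i s)) ht)
  · intro h
    refine ⟨subset_closure (Set.mem_biUnion hs (self_mem_closure_quadrant i s)), fun hi => ?_⟩
    -- A nearby `z` is still in the union while `s` lies in its open quadrant; by transitivity `s`
    -- lies in the open quadrant of some `t`.
    obtain ⟨z, hz, hz'⟩ := mem_closure_iff.1 (mem_closure_setOf_mem_quadrant i s) _
      isOpen_interior hi
    obtain ⟨t, ht, hzt⟩ := Set.mem_iUnion₂.1 (interior_subset hz)
    exact h t ht (mem_quadrant_trans i hzt hz')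

/-! ### Labelled sequences of points

The points are listed from left to right. An item is a number `W < 2 n`; the items `W < n` (early)
and `n + W` (late) both stand for the point with position `W`. A labelled item is a pair `w` of a
Boolean and an item; an early item labelled `true` (`false`) is required to be higher (lower) than
everything to its left, a late one to be higher (lower) than everything to its right. -/

namespace MaxRCH

/-- `w` and `w'` may occur in this order in a labelled sequence. -/
def Compat (n : ℕ) (Q : ℕ → ℝ × ℝ) (w w' : Bool × ℕ) : Prop :=
  (Q w.2).1 < (Q w'.2).1 ∧
  (w'.2 < n → w'.1 = true → (Q w.2).2 < (Q w'.2).2) ∧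
  (w'.2 < n → w'.1 = false → (Q w'.2).2 < (Q w.2).2) ∧
  (n ≤ w.2 → w.1 = true → (Q w'.2).2 < (Q w.2).2) ∧
  (n ≤ w.2 → w.1 = false → (Q w.2).2 < (Q w'.2).2)

/-- The labelled item `w` may be appended to a sequence whose last items labelled `true` and
`false` are `s.1` and `s.2`. -/
def Ok (n : ℕ) (Q : ℕ → ℝ × ℝ) (s : ℕ × ℕ) (w : Bool × ℕ) : Prop :=
  ((Q s.1).1 < (Q w.2).1 ∧ (Q s.2).1 < (Q w.2).1 ∧
    (n ≤ s.1 → (Q w.2).2 < (Q s.1).2) ∧ (n ≤ s.2 → (Q s.2).2 < (Q w.2).2)) ∧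
  (w.2 < n → w.1 = true → (Q s.1).2 < (Q w.2).2 ∧ (Q s.2).2 < (Q w.2).2) ∧
  (w.2 < n → w.1 = false → (Q w.2).2 < (Q s.1).2 ∧ (Q w.2).2 < (Q s.2).2)

/-- The state after appending `w`. -/
def upd (s : ℕ × ℕ) (w : Bool × ℕ) : ℕ × ℕ :=
  if w.1 = true then (w.2, s.2) else (s.1, w.2)

/-- As long as both items are early, the lowest point is below the highest one. -/
def Wf (n : ℕ) (Q : ℕ → ℝ × ℝ) (s : ℕ × ℕ) : Prop :=
  s.1 < n → s.2 < n → (Q s.2).2 ≤ (Q s.1).2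

variable {n : ℕ} {Q : ℕ → ℝ × ℝ}

theorem Wf.upd {s : ℕ × ℕ} {w : Bool × ℕ} (hs : Wf n Q s) (hw : Ok n Q s w) :
    Wf n Q (upd s w) := by
  obtain ⟨u, v⟩ := s
  obtain ⟨t, z⟩ := w
  simp only [Wf, Ok, MaxRCH.upd] at *
  cases t <;> grind

/-- The item replaced by `w` imposes nothing that `w` and the other item do not impose. For
instance, if `w` is early with label `true`, the old top item is early and lower. A later early
`false` item is below the other item of the state, hence below the old top item by `Wf` if that
other item is early; if it is late, no such item is possible. -/
theorem ok_upd_iff {s : ℕ × ℕ} {w w' : Bool × ℕ} (hs : Wf n Q s) (hw : Ok n Q s w) :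
    Ok n Q (upd s w) w' ↔ Ok n Q s w' ∧ Compat n Q w w' := by
  obtain ⟨u, v⟩ := s
  obtain ⟨t, z⟩ := w
  obtain ⟨t', z'⟩ := w'
  simp only [Wf, Ok, Compat, upd] at *
  have h1 := lt_or_ge u n
  have h2 := lt_or_ge v n
  have h3 := lt_or_ge z n
  have h4 := lt_or_ge z' n
  cases t <;> cases t' <;> grind

/-- The labelled items of the list may be appended one after the other. -/
def Accepts (n : ℕ) (Q : ℕ → ℝ × ℝ) : ℕ × ℕ → List (Bool × ℕ) → Prop
  | _, [] => True
  | s, w :: r => Ok n Q s w ∧ Accepts n Q (upd s w) r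

theorem accepts_iff {s : ℕ × ℕ} {r : List (Bool × ℕ)} (hs : Wf n Q s) :
    Accepts n Q s r ↔ (∀ w ∈ r, Ok n Q s w) ∧ r.Pairwise (Compat n Q) := by
  induction r generalizing s with
  | nil => simp [Accepts]
  | cons w r ih =>
    simp only [Accepts, List.pairwise_cons, List.forall_mem_cons]
    constructor
    · rintro ⟨hw, h⟩
      rw [ih (hs.upd hw)] at h
      have := fun w' hw' => (ok_upd_iff hs hw).1 (h.1 w' hw')
      exact ⟨⟨hw, fun w' hw' => (this w' hw').1⟩, fun w' hw' => (this w' hw').2, h.2⟩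
    · rintro ⟨⟨hw, h⟩, h', h''⟩
      refine ⟨hw, (ih (hs.upd hw)).2 ⟨fun w' hw' => ?_, h''⟩⟩
      exact (ok_upd_iff hs hw).2 ⟨h w' hw', h' w' hw'⟩

theorem ok_start_iff {z : ℕ} (hz : z < n) (w : Bool × ℕ) :
    Ok n Q (z, z) w ↔ Compat n Q (true, z) w := by
  simp only [Ok, Compat]
  have : ¬ n ≤ z := by omega
  simp [this]

/-- An early first item demands nothing, as nothing is to its left. It can thus serve as both the
highest and the lowest item so far. -/
theorem accepts_start_iff {z : ℕ} (hz : z < n) {r : List (Bool × ℕ)} :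
    Accepts n Q (z, z) r ↔ ((true, z) :: r).Pairwise (Compat n Q) := by
  rw [accepts_iff (fun _ _ => le_rfl), List.pairwise_cons]
  simp only [ok_start_iff hz]

/-! ### Items of a family of points -/

/-- The point with index `k`. -/
noncomputable def pt {n : ℕ} (p : Fin n → ℝ × ℝ) (k : ℕ) : ℝ × ℝ :=
  if h : k < n then p ⟨k, h⟩ else 0

theorem pt_of_lt {n : ℕ} (p : Fin n → ℝ × ℝ) {k : ℕ} (h : k < n) : pt p k = p ⟨k, h⟩ := by
  simp [pt, h]

/-- `o U` is the index of the point the item `U` stands for. -/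
structure SortedItems {n : ℕ} (p : Fin n → ℝ × ℝ) (o : ℕ → ℕ) : Prop where
  lt : ∀ U < 2 * n, o U < n
  shift : ∀ k < n, o (n + k) = o k
  mono : ∀ i j, i < j → j < n → (pt p (o i)).1 < (pt p (o j)).1
  surj : ∀ i < n, ∃ k < n, o k = i

namespace SortedItems

variable {p : Fin n → ℝ × ℝ} {o : ℕ → ℕ}

/-- Within the early items, and within the late ones, numbers follow the `x`-order, and early
numbers precede late ones; `hl` excludes the one bad case, late followed by early. -/
theorem lt_of_x_lt (h : SortedItems p o) {U W : ℕ} (hU : U < 2 * n) (hW : W < 2 * n)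
    (hx : (pt p (o U)).1 < (pt p (o W)).1) (hl : n ≤ U → n ≤ W) : U < W := by
  have key : ∀ i j, i < n → j < n → (pt p (o i)).1 < (pt p (o j)).1 → i < j := by
    intro i j hi hj hij
    by_contra hc
    rcases (not_lt.1 hc).eq_or_lt with rfl | hc
    · exact lt_irrefl _ hij
    · exact lt_asymm hij (h.mono _ _ hc hi)
  by_cases h1 : U < n
  · by_cases h2 : W < n
    · exact key U W h1 h2 hx
    · omega
  · have h2 := hl (by omega)
    obtain ⟨u, rfl⟩ := Nat.exists_eq_add_of_le (not_lt.1 h1)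
    obtain ⟨w, rfl⟩ := Nat.exists_eq_add_of_le h2
    rw [h.shift u (by omega), h.shift w (by omega)] at hx
    have := key u w (by omega) (by omega) hx
    omega

/-- Appending an item makes the state larger. -/
theorem lt_of_ok (h : SortedItems p o) {s : ℕ × ℕ} (h1 : s.1 < 2 * n) (h2 : s.2 < 2 * n)
    {w : Bool × ℕ} (hw : w.2 < 2 * n) (hok : Ok n (fun U => pt p (o U)) s w) :
    (w.1 = true → s.1 < w.2) ∧ (w.1 = false → s.2 < w.2) := by
  obtain ⟨⟨hx1, hx2, hy1, hy2⟩, ht, hb⟩ := hok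
  constructor
  · intro hw1
    -- A late top item lies above everything to its right, so no early item labelled `true` can
    -- follow it.
    refine h.lt_of_x_lt h1 hw hx1 fun hl => ?_
    by_contra hc
    exact lt_asymm (hy1 hl) (ht (by omega) hw1).1
  · intro hw1
    refine h.lt_of_x_lt h2 hw hx2 fun hl => ?_
    by_contra hc
    exact lt_asymm (hy2 hl) (hb (by omega) hw1).2

theorem pt_mem_range (h : SortedItems p o) {U : ℕ} (hU : U < 2 * n) :
    pt p (o U) ∈ Set.range p := by
  rw [pt_of_lt p (h.lt U hU)]
  exact Set.mem_range_self _

end SortedItems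

/-! ### Labelled sequences versus boundary points of hulls -/

/-- The points of a labelled sequence are all extremal. -/
theorem length_le_boundaryCount {p : Fin n → ℝ × ℝ} (hp : GeneralPosition p)
    (hQ : ∀ U < 2 * n, Q U ∈ Set.range p)
    {r : List (Bool × ℕ)} (hr : r.Pairwise (Compat n Q)) (hlt : ∀ w ∈ r, w.2 < 2 * n) :
    r.length ≤ boundaryCount (Set.range p) {z | ∃ w ∈ r, Q w.2 = z} := by
  set S : Set (ℝ × ℝ) := {z | ∃ w ∈ r, Q w.2 = z} with hS
  have hSp : S ⊆ Set.range p := by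
    rintro z ⟨w, hw, rfl⟩
    exact hQ _ (hlt w hw)
  have hnd : (r.map fun w => Q w.2).Nodup := by
    rw [List.Nodup, List.pairwise_map]
    refine hr.imp fun {a b} hab heq => ?_
    have := hab.1
    rw [heq] at this
    exact lt_irrefl _ this
  have hext : {s ∈ S | ∃ i, s ∈ frontier (quadrantUnion i S)} = S := by
    refine Set.sep_eq_self_iff_mem_true.2 ?_
    rintro z ⟨w, hw, rfl⟩
    have hsym : ∀ a ∈ r, ∀ b ∈ r, a = b ∨ Compat n Q a b ∨ Compat n Q b a := by
      have : Std.Symm fun a b => a = b ∨ Compat n Q a b ∨ Compat n Q b a :=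
        ⟨fun a b h => h.imp Eq.symm Or.symm⟩
      exact fun a ha b hb => List.Pairwise.forall_of_forall
        (R := fun a b => a = b ∨ Compat n Q a b ∨ Compat n Q b a)
        (fun _ _ => Or.inl rfl) (hr.imp fun h => Or.inr (Or.inl h)) ha hb
    have key : ∀ i : Fin 4,
        (∀ w' ∈ r, Compat n Q w w' ∨ Compat n Q w' w → Q w.2 ∉ quadrant i (Q w'.2)) →
        ∃ i, Q w.2 ∈ frontier (quadrantUnion i S) := by
      intro i hi
      refine ⟨i, (mem_frontier_quadrantUnion_iff i (show Q w.2 ∈ S from ⟨w, hw, rfl⟩)).2 ?_⟩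
      rintro _ ⟨w', hw', rfl⟩
      rcases hsym w hw w' hw' with rfl | h
      · fin_cases i <;> simp [quadrant]
      · exact hi w' hw' h
    obtain ⟨t, z⟩ := w
    rcases lt_or_ge z n with hz | hz <;> cases t
    -- Early `false`, early `true`, late `false` and late `true` say that the lower left, upper
    -- left, lower right and upper right quadrant at the point is empty. The index passed to `key`
    -- is that of the opposite quadrant.
    · refine key 0 fun w' _ h => ?_
      simp only [quadrant, Compat, Set.mem_prod, Set.mem_Ioi] at h ⊢
      grind
    · refine key 3 fun w' _ h => ?_
      simp only [quadrant, Compat, Set.mem_prod, Set.mem_Ioi, Set.mem_Iio] at h ⊢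
      grind
    · refine key 1 fun w' _ h => ?_
      simp only [quadrant, Compat, Set.mem_prod, Set.mem_Ioi, Set.mem_Iio] at h ⊢
      grind
    · refine key 2 fun w' _ h => ?_
      simp only [quadrant, Compat, Set.mem_prod, Set.mem_Iio] at h ⊢
      grind
  rw [boundaryCount, inter_frontier_rch p hp S hSp, hext]
  have hS' : S = ((r.map fun w => Q w.2).toFinset : Set (ℝ × ℝ)) := by
    ext z
    simp [hS]
  rw [hS', Set.ncard_coe_finset, List.toFinset_card_of_nodup hnd, List.length_map]

/-- The boundary points of every hull form a labelled sequence. -/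
theorem exists_pairwise_length_eq {p : Fin n → ℝ × ℝ} (hp : GeneralPosition p) {o : ℕ → ℕ}
    (h : SortedItems p o) {S : Set (ℝ × ℝ)} (hS : S ⊆ Set.range p) :
    ∃ r : List (Bool × ℕ), r.Pairwise (Compat n fun U => pt p (o U)) ∧ (∀ w ∈ r, w.2 < 2 * n) ∧
      r.length = boundaryCount (Set.range p) S := by
  classical
  set E : Set (ℝ × ℝ) := {s ∈ S | ∃ i, s ∈ frontier (quadrantUnion i S)} with hE
  -- Extremality gives only weak inequalities, against all of `S`; they become strict between
  -- distinct points because the `y`-coordinates differ.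
  have hlab : ∀ k, ∃ w : Bool × ℕ, k < n → pt p (o k) ∈ E → w.2 < 2 * n ∧ o w.2 = o k ∧
      ∀ t ∈ S, (w.2 < n → w.1 = true → t.1 < (pt p (o k)).1 → t.2 ≤ (pt p (o k)).2) ∧
        (w.2 < n → w.1 = false → t.1 < (pt p (o k)).1 → (pt p (o k)).2 ≤ t.2) ∧
        (n ≤ w.2 → w.1 = true → (pt p (o k)).1 < t.1 → t.2 ≤ (pt p (o k)).2) ∧
        (n ≤ w.2 → w.1 = false → (pt p (o k)).1 < t.1 → (pt p (o k)).2 ≤ t.2) := by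
    intro k
    by_cases hk : k < n ∧ pt p (o k) ∈ E
    · obtain ⟨hk, hkS, i, hi⟩ := hk
      rw [mem_frontier_quadrantUnion_iff i hkS] at hi
      have hsh := h.shift k hk
      fin_cases i
      · refine ⟨(false, k), fun _ _ => ⟨by grind, rfl, fun t ht => ?_⟩⟩
        have := hi t ht
        simp only [quadrant, Set.mem_prod, Set.mem_Ioi] at this
        grind
      · refine ⟨(false, n + k), fun _ _ => ⟨by grind, hsh, fun t ht => ?_⟩⟩
        have := hi t ht
        simp only [quadrant, Set.mem_prod, Set.mem_Ioi, Set.mem_Iio] at this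
        grind
      · refine ⟨(true, n + k), fun _ _ => ⟨by grind, hsh, fun t ht => ?_⟩⟩
        have := hi t ht
        simp only [quadrant, Set.mem_prod, Set.mem_Iio] at this
        grind
      · refine ⟨(true, k), fun _ _ => ⟨by grind, rfl, fun t ht => ?_⟩⟩
        have := hi t ht
        simp only [quadrant, Set.mem_prod, Set.mem_Ioi, Set.mem_Iio] at this
        grind
    -- An arbitrary label for positions that are not used.
    · exact ⟨(true, 0), fun h1 h2 => absurd ⟨h1, h2⟩ hk⟩
  choose l hl using hlab
  set K : Finset ℕ := (Finset.range n).filter fun k => pt p (o k) ∈ E with hK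
  have hKm : ∀ k ∈ K.sort (· ≤ ·), k < n ∧ pt p (o k) ∈ E := by
    intro k hk
    simpa [hK] using hk
  refine ⟨(K.sort (· ≤ ·)).map l, ?_, ?_, ?_⟩
  · rw [List.pairwise_map]
    refine (K.sortedLT_sort).pairwise.imp_of_mem fun {a b} ha hb hab => ?_
    obtain ⟨ha1, ha2⟩ := hKm a ha
    obtain ⟨hb1, hb2⟩ := hKm b hb
    obtain ⟨-, hao, ha3⟩ := hl a ha1 ha2
    obtain ⟨-, hbo, hb3⟩ := hl b hb1 hb2
    have hx := h.mono a b hab hb1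
    have hy : (pt p (o a)).2 ≠ (pt p (o b)).2 := by
      rw [pt_of_lt p (h.lt a (by omega)), pt_of_lt p (h.lt b (by omega))] at hx ⊢
      intro heq
      have := hp.2 heq
      rw [this] at hx
      exact lt_irrefl _ hx
    have h1 := ha3 _ hb2.1
    have h2 := hb3 _ ha2.1
    simp only [Compat, hao, hbo]
    grind
  · intro w hw
    obtain ⟨k, hk, rfl⟩ := List.mem_map.1 hw
    exact (hl k (hKm k hk).1 (hKm k hk).2).1
  · rw [boundaryCount, inter_frontier_rch p hp S hS, List.length_map, Finset.length_sort,
      ← Set.ncard_coe_finset]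
    have hinj : Set.InjOn (fun k => pt p (o k)) (K : Set ℕ) := by
      intro a ha b hb hab
      simp only [hK, Finset.coe_filter, Finset.mem_range, Set.mem_ofPred_eq] at ha hb
      rcases lt_trichotomy a b with hlt | heq | hlt
      · exact absurd (congrArg Prod.fst hab) (h.mono a b hlt hb.1).ne
      · exact heq
      · exact absurd (congrArg Prod.fst hab) (h.mono b a hlt ha.1).ne'
    rw [← hinj.ncard_image]
    congr 1
    ext z
    simp only [hK, Finset.coe_filter, Finset.mem_range, Set.mem_image, Set.mem_ofPred_eq]
    constructor
    · rintro ⟨k, ⟨-, hk⟩, rfl⟩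
      exact hk
    · intro hz
      obtain ⟨i, rfl⟩ := hS hz.1
      obtain ⟨k, hk, hki⟩ := h.surj i i.2
      have : pt p (o k) = p i := by
        rw [hki, pt_of_lt p i.2]
      exact ⟨k, ⟨hk, this ▸ hz⟩, this⟩

/-- The first item of a sequence may be replaced by the early item of the same point: its early
condition is void and its late condition is dropped. Hence the start states `(z, z)` with `z < n`
suffice. -/
theorem boundaryCount_le {p : Fin n → ℝ × ℝ} (hp : GeneralPosition p) {o : ℕ → ℕ}
    (h : SortedItems p o) {K : ℕ}
    (hK : ∀ z < n, ∀ r, (∀ w ∈ r, w.2 < 2 * n) →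
      Accepts n (fun U => pt p (o U)) (z, z) r → r.length + 1 ≤ K)
    {S : Set (ℝ × ℝ)} (hS : S ⊆ Set.range p) : boundaryCount (Set.range p) S ≤ K := by
  obtain ⟨r, hr, hlt, hlen⟩ := exists_pairwise_length_eq hp h hS
  rw [← hlen]
  cases r with
  | nil => simp
  | cons w r =>
    rw [List.forall_mem_cons] at hlt
    obtain ⟨z, hz, hzo⟩ : ∃ z < n, o z = o w.2 := by
      rcases lt_or_ge w.2 n with hw | hw
      · exact ⟨w.2, hw, rfl⟩
      · obtain ⟨z, hz⟩ := Nat.exists_eq_add_of_le hw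
        exact ⟨z, by omega, by rw [hz, h.shift z (by omega)]⟩
    refine hK z hz r hlt.2 ((accepts_start_iff hz).2 ?_)
    rw [List.pairwise_cons] at hr ⊢
    refine ⟨fun w' hw' => ?_, hr.2⟩
    have := hr.1 w' hw'
    simp only [Compat, hzo] at this ⊢
    grind

theorem length_succ_le_boundaryCount {p : Fin n → ℝ × ℝ} (hp : GeneralPosition p) {o : ℕ → ℕ}
    (h : SortedItems p o) {z : ℕ} (hz : z < n) {r : List (Bool × ℕ)} (hlt : ∀ w ∈ r, w.2 < 2 * n)
    (hr : Accepts n (fun U => pt p (o U)) (z, z) r) :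
    r.length + 1 ≤ boundaryCount (Set.range p)
      {x | ∃ w ∈ (true, z) :: r, pt p (o w.2) = x} :=
  length_le_boundaryCount (r := (true, z) :: r) hp (fun _ hU => h.pt_mem_range hU)
    ((accepts_start_iff hz).1 hr) (List.forall_mem_cons.2 ⟨by simp; omega, hlt⟩)

end MaxRCH

/-! ### Total correctness of programs -/

namespace RAM

variable {n : ℕ} {p : Fin n → ℝ × ℝ} {M : ℕ}

/-- On the memory content `m`, the program `c` halts within `t` steps with a memory content that
satisfies `P`. -/
def WP (p : Fin n → ℝ × ℝ) (M : ℕ) (c : Prog) (t : ℕ) (m : ℕ → ℕ) (P : (ℕ → ℕ) → Prop) : Prop :=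
  ∃ t' ≤ t, ∃ m', Exec p M c m t' m' ∧ P m'

/-- An upper bound for the running time of a program without loops. -/
def Prog.cost : Prog → ℕ
  | .skip => 1
  | .assign a e => a.cost + e.cost + 1
  | .seq c d => c.cost + d.cost
  | .ite b c d => b.cost + (c.cost + d.cost)
  | .loop _ _ => 0

theorem WP.mono {c : Prog} {t u : ℕ} {m : ℕ → ℕ} {P R : (ℕ → ℕ) → Prop} (h : WP p M c t m P)
    (htu : t ≤ u) (hPR : ∀ m', P m' → R m') : WP p M c u m R := by
  obtain ⟨t', ht, m', he, hP⟩ := h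
  exact ⟨t', ht.trans htu, m', he, hPR m' hP⟩

theorem wp_skip {m : ℕ → ℕ} {P : (ℕ → ℕ) → Prop} (h : P m) : WP p M .skip Prog.skip.cost m P :=
  ⟨1, le_rfl, m, .skip m, h⟩

theorem wp_assign {a e : Expr} {m : ℕ → ℕ} {P : (ℕ → ℕ) → Prop} (ha : a.Safe M m)
    (he : e.Safe M m) (h : P (Function.update m (a.eval m) (e.eval m))) :
    WP p M (.assign a e) (Prog.assign a e).cost m P :=
  ⟨_, le_rfl, _, .assign a e m ha he, h⟩

theorem wp_seq {c d : Prog} {t u : ℕ} {m : ℕ → ℕ} {P : (ℕ → ℕ) → Prop}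
    (h : WP p M c t m fun m' => WP p M d u m' P) : WP p M (.seq c d) (t + u) m P := by
  obtain ⟨t', ht, m', he, u', hu, m'', he', hP⟩ := h
  exact ⟨_, Nat.add_le_add ht hu, _, .seq he he', hP⟩

theorem wp_ite {b : Test} {c d : Prog} {t u : ℕ} {m : ℕ → ℕ} {P : (ℕ → ℕ) → Prop}
    (hs : b.Safe n M m) (hc : b.eval p m → WP p M c t m P) (hd : ¬ b.eval p m → WP p M d u m P) :
    WP p M (.ite b c d) (b.cost + (t + u)) m P := by
  by_cases hb : b.eval p m
  · obtain ⟨t', ht, m', he, hP⟩ := hc hb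
    exact ⟨_, by omega, _, .ite_true hs hb he, hP⟩
  · obtain ⟨t', ht, m', he, hP⟩ := hd hb
    exact ⟨_, by omega, _, .ite_false hs hb he, hP⟩

/-- The rule for loops; `I k` is the invariant when `k` iterations remain. -/
theorem wp_loop {b : Test} {c : Prog} {τ : ℕ} (I : ℕ → (ℕ → ℕ) → Prop)
    (h0 : ∀ m, I 0 m → b.Safe n M m ∧ ¬ b.eval p m)
    (hstep : ∀ k m, I (k + 1) m → b.Safe n M m ∧ b.eval p m ∧ WP p M c τ m (I k))
    (k : ℕ) (m : ℕ → ℕ) (hm : I k m) :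
    WP p M (.loop b c) (k * (b.cost + τ) + b.cost) m (I 0) := by
  induction k generalizing m with
  | zero => exact ⟨_, by omega, m, .loop_false (h0 m hm).1 (h0 m hm).2, hm⟩
  | succ k ih =>
    obtain ⟨hs, hb, t', ht, m', he, hI⟩ := hstep k m hm
    obtain ⟨u', hu, m'', he', hP⟩ := ih m' hI
    refine ⟨_, ?_, _, .loop_true hs hb he he', hP⟩
    rw [Nat.succ_mul]
    omega

open MaxRCH in
theorem eval_xlt {m : ℕ → ℕ} {e f : Expr} (he : e.eval m < n) (hf : f.eval m < n) :
    (Test.xlt e f).eval p m ↔ (pt p (e.eval m)).1 < (pt p (f.eval m)).1 := by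
  simp [Test.eval, pt, he, hf]

open MaxRCH in
theorem eval_ylt {m : ℕ → ℕ} {e f : Expr} (he : e.eval m < n) (hf : f.eval m < n) :
    (Test.ylt e f).eval p m ↔ (pt p (e.eval m)).2 < (pt p (f.eval m)).2 := by
  simp [Test.eval, pt, he, hf]

end RAM

/-! ### The program

The variables are kept in the cells `8 k`. The cells `8 s + 1`, `8 s + 2`, `8 s + 4` belong to the
state `(U, V)` with number `s = U N + V`, where `N = 2 n`: the maximum number of items that can be
appended, and the next state `(U', V')` of an optimal continuation, stored as `U' + 1` (or `0` if
there is none) and `V'`. The number `N ^ 2` stands for the empty sequence. The cell `8 U + 3` holds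
the index of the point of the item `U`. -/

namespace MaxRCH

open RAM

/-- The variable with number `k`. -/
def var (k : ℕ) : Expr := .cell (.const (8 * k))

/-- The assignment of the value of `e` to the variable with number `k`. -/
def setVar (k : ℕ) (e : Expr) : Prog := .assign (.const (8 * k)) e

/-- The address of the cell of the table `r` with number `e`. -/
def addr (r : ℕ) (e : Expr) : Expr := .add (.mul (.const 8) e) (.const r)

/-- The number of the state whose items are the variables `a` and `b`. -/
def stateNo (a b : ℕ) : Expr := .add (.mul (var a) (var 1)) (var b)

/-- The index of the point of the item in the variable `a`. -/
def item (a : ℕ) : Expr := .cell (addr 3 (var a))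

/-- Take the state whose items are the variables `a` and `b` as successor of the current state if
this is an improvement. -/
def relax (a b : ℕ) : Prog :=
  .ite (.lt (.cell (addr 1 (var 8))) (.add (.cell (addr 1 (stateNo a b))) (.const 1)))
    (.seq (.assign (addr 1 (var 8)) (.add (.cell (addr 1 (stateNo a b))) (.const 1)))
      (.seq (.assign (addr 2 (var 8)) (.add (var a) (.const 1)))
        (.assign (addr 4 (var 8)) (var b))))
    .skip

/-! ### Table entries and the relaxation step -/

/-- The number of the state `T`. -/
def num (N : ℕ) (T : ℕ × ℕ) : ℕ := T.1 * N + T.2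

theorem num_lt {N : ℕ} {T : ℕ × ℕ} (h1 : T.1 < N) (h2 : T.2 < N) : num N T < N * N := by
  unfold num
  nlinarith

/-- The table entries of the state with number `s` are as they should be if `C` is the set of
possible successors. -/
def Entry (N : ℕ) (m : ℕ → ℕ) (s : ℕ) (C : Set (ℕ × ℕ)) : Prop :=
  (∀ T ∈ C, m (8 * num N T + 1) + 1 ≤ m (8 * s + 1)) ∧
  ((m (8 * s + 1) = 0 ∧ m (8 * s + 2) = 0 ∧ m (8 * s + 4) = 0) ∨
    ∃ T ∈ C, m (8 * s + 1) = m (8 * num N T + 1) + 1 ∧ m (8 * s + 2) = T.1 + 1 ∧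
      m (8 * s + 4) = T.2)

/-- `m'` arises from `m` by changing the table entries of `s`. -/
def Frame (s : ℕ) (m m' : ℕ → ℕ) : Prop :=
  ∀ a, a ≠ 8 * s + 1 → a ≠ 8 * s + 2 → a ≠ 8 * s + 4 → m' a = m a

theorem Frame.trans {s : ℕ} {m m' m'' : ℕ → ℕ} (h : Frame s m m') (h' : Frame s m' m'') :
    Frame s m m'' := fun a h1 h2 h3 => (h' a h1 h2 h3).trans (h a h1 h2 h3)

theorem Frame.refl (s : ℕ) (m : ℕ → ℕ) : Frame s m m := fun _ _ _ _ => rfl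

variable {n M N : ℕ} {p : Fin n → ℝ × ℝ} {o : ℕ → ℕ}

/-- All candidates have numbers other than `s`, so overwriting the entry of `s` does not disturb the
values it is compared with. The bound `N * N + 1` in `h1` leaves room for the entry of the empty
sequence, which exceeds a state value by one. -/
theorem wp_relax {a b s u v : ℕ} {m : ℕ → ℕ} {C : Set (ℕ × ℕ)} (hM : 8 * (N * N) + n + 300 ≤ M)
    (ha : a < 10) (hb : b < 10) (hN : m 8 = N) (hs : m 64 = s) (hu : m (8 * a) = u)
    (hv : m (8 * b) = v) (huN : u < N) (hvN : v < N) (hsN : s ≤ N * N)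
    (h1 : m (8 * s + 1) ≤ N * N + 1) (h2 : m (8 * num N (u, v) + 1) ≤ N * N)
    (hE : Entry N m s C) (hC : ∀ T ∈ C, num N T ≠ s) (hT : num N (u, v) ≠ s) :
    WP p M (relax a b) (relax a b).cost m
      fun m' => Entry N m' s (insert (u, v) C) ∧ Frame s m m' := by
  have hnum := num_lt (T := (u, v)) huN hvN
  have hNM : N ≤ N * N := Nat.le_mul_self N
  simp only [num] at hnum h2 hT
  have hlt : u * N < N * N := by omega
  have e1 : (addr 1 (var 8)).eval m = 8 * s + 1 := by
    simp [addr, var, Expr.eval, hs]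
  have s1 : (addr 1 (var 8)).Safe M m := by
    simp [addr, var, Expr.eval, Expr.Safe, hs]; omega
  have e2 : (addr 1 (stateNo a b)).eval m = 8 * (u * N + v) + 1 := by
    simp [addr, stateNo, var, Expr.eval, hu, hv, hN]
  have s2 : (addr 1 (stateNo a b)).Safe M m := by
    simp [addr, stateNo, var, Expr.eval, Expr.Safe, hu, hv, hN]; omega
  have e3 : (stateNo a b).eval m = u * N + v := by
    simp [stateNo, var, Expr.eval, hu, hv, hN]
  refine wp_ite ?_ (fun h => wp_seq ?_) (fun h => wp_skip ?_)
  · simp only [Test.Safe, Expr.Safe, Expr.eval, s1, e1, s2, e2, true_and]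
    omega
  · simp only [Test.eval, Expr.eval, e1, e2] at h
    refine wp_assign s1 ?_ (wp_seq (wp_assign ?_ ?_ (wp_assign ?_ ?_ ?_)))
    · simp only [Expr.Safe, Expr.eval, s2, e2, true_and]
      omega
    all_goals
      simp (disch := omega) only [Expr.Safe, Expr.eval, e3, addr, var, Function.update_of_ne,
        hs, hu, hv, Nat.reduceMul]
    · omega
    · omega
    · omega
    · omega
    · refine ⟨⟨?_, Or.inr ⟨(u, v), Set.mem_insert _ _, ?_⟩⟩, ?_⟩
      · intro T hTC
        rcases hTC with rfl | hTC
        · simp (disch := omega) [num, Function.update_of_ne]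
        · have h3 := hC T hTC
          have h4 := hE.1 T hTC
          simp (disch := omega) [Function.update_of_ne]
          omega
      · simp (disch := omega) [num, Function.update_of_ne]
      · intro c hc1 hc2 hc3
        simp (disch := omega) [Function.update_of_ne]
  · simp only [Test.eval, Expr.eval, e1, e2] at h
    refine ⟨⟨?_, ?_⟩, Frame.refl _ _⟩
    · rintro T (rfl | hTC)
      · simp only [num]; omega
      · exact hE.1 T hTC
    · exact hE.2.imp id fun ⟨T, hTC, h⟩ => ⟨T, Set.mem_insert_of_mem _ hTC, h⟩

/-! ### Trying one item as the next one -/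

/-- The test whether the item in the variable `7` may be appended as an item of some kind to the
state in the variables `5` and `6`, apart from the conditions for early items. -/
def baseTest : Test :=
  .and (.and (.xlt (item 5) (item 7)) (.xlt (item 6) (item 7)))
    (.and (.not (.and (.not (.lt (var 5) (var 0))) (.not (.ylt (item 7) (item 5)))))
      (.not (.and (.not (.lt (var 6) (var 0))) (.not (.ylt (item 6) (item 7))))))

/-- The condition for early items labelled `true`. -/
def topTest : Test :=
  .not (.and (.lt (var 7) (var 0))
    (.not (.and (.ylt (item 5) (item 7)) (.ylt (item 6) (item 7)))))

/-- The condition for early items labelled `false`. -/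
def botTest : Test :=
  .not (.and (.lt (var 7) (var 0))
    (.not (.and (.ylt (item 7) (item 5)) (.ylt (item 7) (item 6)))))

/-- Consider the item in the variable `7` as the next one. -/
def tryItem : Prog :=
  .ite baseTest (.seq (.ite topTest (relax 7 6) .skip) (.ite botTest (relax 5 7) .skip)) .skip

/-- The memory contains the data that are used throughout. -/
structure Env (n N : ℕ) (o m : ℕ → ℕ) : Prop where
  n_eq : m 0 = n
  N_eq : m 8 = N
  item_eq : ∀ i < N, m (8 * i + 3) = o i

/-- The states that arise from `s` by appending an item less than `k`. -/
def successors (n : ℕ) (Q : ℕ → ℝ × ℝ) (s : ℕ × ℕ) (k : ℕ) : Set (ℕ × ℕ) :=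
  {T | ∃ w, w.2 < k ∧ Ok n Q s w ∧ T = upd s w}

theorem Env.frame {s : ℕ} {m m' : ℕ → ℕ} (h : Env n N o m) (hf : Frame s m m') : Env n N o m' :=
  ⟨by rw [hf _ (by omega) (by omega) (by omega), h.n_eq],
    by rw [hf _ (by omega) (by omega) (by omega), h.N_eq],
    fun i hi => by rw [hf _ (by omega) (by omega) (by omega), h.item_eq i hi]⟩

theorem item_spec (ho : SortedItems p o) (hN : N = 2 * n) (hM : 8 * (N * N) + n + 300 ≤ M)
    {m : ℕ → ℕ} (hm : Env n N o m) {a u : ℕ} (ha : a < 10) (hu : m (8 * a) = u) (huN : u < N) :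
    (item a).Safe M m ∧ (item a).eval m = o u ∧ o u < n := by
  have := ho.lt u (by omega)
  have hNM : N ≤ N * N := Nat.le_mul_self N
  have h3 := hm.item_eq u huN
  refine ⟨?_, ?_, this⟩
  · simp only [item, addr, var, Expr.Safe, Expr.eval, hu, h3]
    omega
  · simp only [item, addr, var, Expr.eval, hu, h3]

/-- One coordinate grows and the other is kept, so the state graph is acyclic and decreasing numbers
are a valid order of evaluation. -/
theorem num_upd (ho : SortedItems p o) (hN : N = 2 * n) {s : ℕ × ℕ} {w : Bool × ℕ}
    (h1 : s.1 < N) (h2 : s.2 < N) (hw : w.2 < N) (hok : Ok n (fun U => pt p (o U)) s w) :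
    (upd s w).1 < N ∧ (upd s w).2 < N ∧ num N s < num N (upd s w) := by
  subst hN
  obtain ⟨ht, hb⟩ := ho.lt_of_ok h1 h2 hw hok
  obtain ⟨t, z⟩ := w
  unfold upd num
  cases t
  · have := hb rfl
    simp_all
  · have : (s.1 + 1) * (2 * n) ≤ z * (2 * n) := Nat.mul_le_mul_right _ (ht rfl)
    rw [Nat.add_mul] at this
    simp_all
    omega

theorem successors_spec (ho : SortedItems p o) (hN : N = 2 * n) {s : ℕ × ℕ} {k : ℕ}
    (h1 : s.1 < N) (h2 : s.2 < N) (hk : k ≤ N) :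
    ∀ T ∈ successors n (fun U => pt p (o U)) s k, T.1 < N ∧ T.2 < N ∧ num N s < num N T := by
  rintro _ ⟨w, hw, hok, rfl⟩
  exact num_upd ho hN h1 h2 (by omega) hok

/-- Each appended item raises the state number by at least one. This crude bound keeps all table
values within the word size. -/
theorem Entry.le {m : ℕ → ℕ} {s : ℕ} {C : Set (ℕ × ℕ)} (hE : Entry N m s C)
    (hC : ∀ T ∈ C, s < num N T ∧ num N T < N * N ∧ m (8 * num N T + 1) ≤ N * N - num N T) :
    m (8 * s + 1) ≤ N * N - s := by
  rcases hE.2 with h | ⟨T, hT, h, -⟩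
  · omega
  · have := hC T hT
    omega

/-- The same item may lead to two successors, one for each label, and each is relaxed separately.
Only entries with larger numbers are read, which is why `hF` suffices. -/
theorem wp_tryItem (ho : SortedItems p o) (hN : N = 2 * n) (hM : 8 * (N * N) + n + 300 ≤ M)
    {m : ℕ → ℕ} (hm : Env n N o m) {U V W s : ℕ} (h5 : m 40 = U) (h6 : m 48 = V) (h7 : m 56 = W)
    (h8 : m 64 = s) (hU : U < N) (hV : V < N) (hW : W < N) (hs : s = num N (U, V))
    (hF : ∀ T : ℕ × ℕ, T.1 < N → T.2 < N → s < num N T → m (8 * num N T + 1) ≤ N * N - num N T)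
    (hE : Entry N m s (successors n (fun U => pt p (o U)) (U, V) W)) :
    WP p M tryItem tryItem.cost m fun m' =>
      Entry N m' s (successors n (fun U => pt p (o U)) (U, V) (W + 1)) ∧ Frame s m m' := by
  obtain ⟨sU, eU, lU⟩ := item_spec (a := 5) ho hN hM hm (by omega) h5 hU
  obtain ⟨sV, eV, lV⟩ := item_spec (a := 6) ho hN hM hm (by omega) h6 hV
  obtain ⟨sW, eW, lW⟩ := item_spec (a := 7) ho hN hM hm (by omega) h7 hW
  have hNM : N ≤ N * N := Nat.le_mul_self N
  have h0 := hm.n_eq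
  set Q : ℕ → ℝ × ℝ := fun U => pt p (o U) with hQ
  have hsN : s < N * N := hs ▸ num_lt (T := (U, V)) hU hV
  have hspec := successors_spec (k := W) ho hN (s := (U, V)) hU hV hW.le
  have hspec' := successors_spec (k := W + 1) ho hN (s := (U, V)) hU hV hW
  rw [← hs] at hspec hspec'
  have sub : ∀ t, Ok n Q (U, V) (t, W) → upd (U, V) (t, W) ∈ successors n Q (U, V) (W + 1) :=
    fun t h => ⟨(t, W), Nat.lt_succ_self W, h, rfl⟩
  have hvar : ∀ {m'}, Frame s m m' → m' 40 = U ∧ m' 48 = V ∧ m' 56 = W ∧ m' 64 = s := by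
    intro m' hf
    refine ⟨?_, ?_, ?_, ?_⟩ <;> rw [hf _ (by omega) (by omega) (by omega)] <;> assumption
  have evb : baseTest.eval p m ↔ ((Q U).1 < (Q W).1 ∧ (Q V).1 < (Q W).1 ∧
      (n ≤ U → (Q W).2 < (Q U).2) ∧ (n ≤ V → (Q V).2 < (Q W).2)) := by
    have x1 := @eval_xlt n p m (item 5) (item 7) (by omega) (by omega)
    have x2 := @eval_xlt n p m (item 6) (item 7) (by omega) (by omega)
    have y1 := @eval_ylt n p m (item 7) (item 5) (by omega) (by omega)
    have y2 := @eval_ylt n p m (item 6) (item 7) (by omega) (by omega)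
    rw [eU, eW] at x1 y1
    rw [eV, eW] at x2 y2
    -- Only the connectives and `lt` are unfolded, so that coordinate comparisons still match the
    -- equivalences above.
    simp only [baseTest, Test.eval.eq_4, Test.eval.eq_5, x1, x2, y1, y2, Test.eval.eq_1]
    simp only [var, Expr.eval, Nat.reduceMul, h0, h5, h6, hQ]
    grind
  have evt : topTest.eval p m ↔ (W < n → (Q U).2 < (Q W).2 ∧ (Q V).2 < (Q W).2) := by
    have y1 := @eval_ylt n p m (item 5) (item 7) (by omega) (by omega)
    have y2 := @eval_ylt n p m (item 6) (item 7) (by omega) (by omega)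
    rw [eU, eW] at y1
    rw [eV, eW] at y2
    simp only [topTest, Test.eval.eq_4, Test.eval.eq_5, y1, y2, Test.eval.eq_1]
    simp only [var, Expr.eval, Nat.reduceMul, h0, h7, hQ]
    grind
  have evo : ∀ {m'}, Frame s m m' → (botTest.Safe n M m' ∧ (botTest.eval p m' ↔
      (W < n → (Q W).2 < (Q U).2 ∧ (Q W).2 < (Q V).2))) := by
    intro m' hf
    have hm' := hm.frame hf
    obtain ⟨h5', h6', h7', -⟩ := hvar hf
    have h0' := hm'.n_eq
    obtain ⟨sU, eU, lU⟩ := item_spec (a := 5) ho hN hM hm' (by omega) h5' hU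
    obtain ⟨sV, eV, lV⟩ := item_spec (a := 6) ho hN hM hm' (by omega) h6' hV
    obtain ⟨sW, eW, lW⟩ := item_spec (a := 7) ho hN hM hm' (by omega) h7' hW
    have y1 := @eval_ylt n p m' (item 7) (item 5) (by omega) (by omega)
    have y2 := @eval_ylt n p m' (item 7) (item 6) (by omega) (by omega)
    rw [eU, eW] at y1
    rw [eV, eW] at y2
    constructor
    · simp only [botTest, Test.Safe, sU, sV, sW, eU, eV, eW]
      simp only [var, Expr.Safe, Expr.eval, Nat.reduceMul, h0', h7', true_and]
      omega
    · simp only [botTest, Test.eval.eq_4, Test.eval.eq_5, y1, y2, Test.eval.eq_1]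
      simp only [var, Expr.eval, Nat.reduceMul, h0', h7', hQ]
      grind
  have hmono : ∀ T ∈ successors n Q (U, V) W, T ∈ successors n Q (U, V) (W + 1) :=
    fun T ⟨w, hw, h⟩ => ⟨w, by omega, h⟩
  have hcases : ∀ T ∈ successors n Q (U, V) (W + 1), T ∈ successors n Q (U, V) W ∨
      ∃ t, Ok n Q (U, V) (t, W) ∧ T = upd (U, V) (t, W) := by
    rintro T ⟨⟨t, z⟩, hw, h, rfl⟩
    rcases (Nat.lt_succ_iff.1 hw).eq_or_lt with hz | hz
    · simp only at hz
      subst hz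
      exact Or.inr ⟨t, h, rfl⟩
    · exact Or.inl ⟨_, hz, h, rfl⟩
  have hFm : ∀ {m'}, Frame s m m' → ∀ T ∈ successors n Q (U, V) (W + 1),
      s < num N T ∧ num N T < N * N ∧ m' (8 * num N T + 1) ≤ N * N - num N T := by
    intro m' hf T hT
    obtain ⟨hT1, hT2, hT3⟩ := hspec' T hT
    refine ⟨hT3, num_lt hT1 hT2, ?_⟩
    rw [hf _ (by omega) (by omega) (by omega)]
    exact hF T hT1 hT2 hT3
  refine wp_ite ?_ (fun hb => wp_seq ?_) (fun hb => ?_)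
  · simp only [baseTest, Test.Safe, sU, sV, sW, eU, eV, eW]
    simp only [var, Expr.Safe, Expr.eval, Nat.reduceMul, h0, h5, h6, true_and]
    omega
  · rw [evb] at hb
    -- The second relaxation starts from whatever the first left behind: `C` may or may not contain
    -- the successor for the label `true`.
    have second : ∀ {m'} {C : Set (ℕ × ℕ)}, Frame s m m' → Entry N m' s C →
        (∀ T ∈ C, T ∈ successors n Q (U, V) (W + 1)) →
        (∀ T ∈ successors n Q (U, V) (W + 1), T ∈ C ∨
          Ok n Q (U, V) (false, W) ∧ T = upd (U, V) (false, W)) →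
        WP p M (.ite botTest (relax 5 7) .skip) (Prog.ite botTest (relax 5 7) .skip).cost m'
          fun m' => Entry N m' s (successors n Q (U, V) (W + 1)) ∧ Frame s m m' := by
      intro m' C hf hE' hC1 hC2
      have hv := hvar hf
      have hC' := fun T hT => hFm hf T (hC1 T hT)
      refine wp_ite (evo hf).1 (fun h => ?_) (fun h => ?_)
      · rw [(evo hf).2] at h
        have hok : Ok n Q (U, V) (false, W) :=
          ⟨hb, fun _ h => absurd h (by simp), fun hW _ => h hW⟩
        have hU' := hFm hf _ (sub false hok)
        have hle := hE'.le hC'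
        refine (wp_relax hM (by omega) (by omega) (hm.frame hf).N_eq hv.2.2.2 hv.1 hv.2.2.1 hU hW
          hsN.le (by omega) (hU'.2.2.trans (Nat.sub_le _ _)) hE' (fun T hT => (hC' T hT).1.ne')
          hU'.1.ne').mono le_rfl fun m'' h'' => ⟨?_, hf.trans h''.2⟩
        convert h''.1 using 1
        refine Set.Subset.antisymm (fun T hT => ?_) ?_
        · rcases hC2 T hT with h | h
          · exact Or.inr h
          · exact Or.inl h.2
        · rintro T (rfl | hT)
          · exact sub false hok
          · exact hC1 T hT
      · refine wp_skip ⟨?_, hf⟩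
        convert hE' using 1
        refine Set.Subset.antisymm (fun T hT => ?_) hC1
        rcases hC2 T hT with h' | ⟨h', -⟩
        · exact h'
        · exact absurd ((evo hf).2.2 fun hW => h'.2.2 hW rfl) h
    refine wp_ite ?_ (fun h => ?_) (fun h => ?_)
    · simp only [topTest, Test.Safe, sU, sV, sW, eU, eV, eW]
      simp only [var, Expr.Safe, Expr.eval, Nat.reduceMul, h0, h7, true_and]
      omega
    · rw [evt] at h
      have hok : Ok n Q (U, V) (true, W) :=
        ⟨hb, fun hW _ => h hW, fun _ h => absurd h (by simp)⟩
      have hf := Frame.refl s m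
      have hC' := fun T hT => hFm hf T (hmono T hT)
      have hU' := hFm hf _ (sub true hok)
      have hle := hE.le hC'
      refine (wp_relax hM (by omega) (by omega) hm.N_eq h8 h7 h6 hW hV
          hsN.le (by omega) (hU'.2.2.trans (Nat.sub_le _ _)) hE (fun T hT => (hC' T hT).1.ne')
          hU'.1.ne').mono le_rfl fun m' h' => second h'.2 h'.1 ?_ ?_
      · rintro T (rfl | hT)
        · exact sub true hok
        · exact hmono T hT
      · intro T hT
        rcases hcases T hT with h | ⟨t, h, hTe⟩
        · exact Or.inl (Or.inr h)
        · cases t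
          · exact Or.inr ⟨h, hTe⟩
          · exact Or.inl (Or.inl hTe)
    · refine wp_skip (second (Frame.refl s m) hE hmono fun T hT => ?_)
      rcases hcases T hT with h' | ⟨t, h', hTe⟩
      · exact Or.inl h'
      · cases t
        · exact Or.inr ⟨h', hTe⟩
        · exact absurd (evt.2 fun hW => h'.2.1 hW rfl) h
  · refine WP.mono (wp_skip ⟨?_, Frame.refl _ _⟩) (by simp [Prog.cost]) (fun _ h => h)
    have : successors n Q (U, V) (W + 1) = successors n Q (U, V) W := by
      refine Set.Subset.antisymm (fun T hT => ?_) hmono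
      rcases hcases T hT with h | ⟨t, h, -⟩
      · exact h
      · exact absurd (evb.2 h.1) hb
    rwa [this]

/-! ### Filling the table -/

/-- Consider all items as the next one. -/
def itemLoop : Prog :=
  .loop (.lt (var 7) (var 1)) (.seq tryItem (setVar 7 (.add (var 7) (.const 1))))

/-- Start a table entry for the state with number `e`. -/
def newEntry (e : Expr) : Prog :=
  .seq (setVar 8 e) (.seq (.assign (addr 1 (var 8)) (.const 0))
    (.seq (.assign (addr 2 (var 8)) (.const 0)) (.seq (.assign (addr 4 (var 8)) (.const 0))
      (setVar 7 (.const 0)))))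

/-- Compute the table entries of the states with first item in the variable `5`. -/
def rowLoop : Prog :=
  .loop (.lt (.const 0) (var 6))
    (.seq (setVar 6 (.sub (var 6) (.const 1))) (.seq (newEntry (stateNo 5 6)) itemLoop))

/-- Compute the table entries of all states. -/
def stateLoop : Prog :=
  .seq (setVar 5 (var 1)) (.loop (.lt (.const 0) (var 5))
    (.seq (setVar 5 (.sub (var 5) (.const 1))) (.seq (setVar 6 (var 1)) rowLoop)))

/-- Compute the table entry of the empty sequence. -/
def firstLoop : Prog :=
  .seq (newEntry (.mul (var 1) (var 1))) (.loop (.lt (var 7) (var 0))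
    (.seq (relax 7 7) (setVar 7 (.add (var 7) (.const 1)))))

/-- The table entries of all states with numbers at least `q` are correct. -/
def Done (n N : ℕ) (Q : ℕ → ℝ × ℝ) (m : ℕ → ℕ) (q : ℕ) : Prop :=
  ∀ T : ℕ × ℕ, T.1 < N → T.2 < N → q ≤ num N T →
    Entry N m (num N T) (successors n Q T N) ∧ m (8 * num N T + 1) ≤ N * N - num N T

theorem num_injective {T T' : ℕ × ℕ} (h : T.2 < N) (h' : T'.2 < N) (he : num N T = num N T') :
    T = T' := by
  have hN : 0 < N := by omega
  unfold num at he
  have h1 := congrArg (· / N) he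
  have h2 := congrArg (· % N) he
  simp only [Nat.add_comm (_ * N), Nat.add_mul_div_right _ _ hN, Nat.div_eq_of_lt h,
    Nat.div_eq_of_lt h', Nat.add_mul_mod_self_right, Nat.mod_eq_of_lt h,
    Nat.mod_eq_of_lt h'] at h1 h2
  exact Prod.ext (by omega) h2

theorem Entry.congr {m m' : ℕ → ℕ} {s : ℕ} {C : Set (ℕ × ℕ)} (hE : Entry N m s C)
    (h1 : m' (8 * s + 1) = m (8 * s + 1)) (h2 : m' (8 * s + 2) = m (8 * s + 2))
    (h4 : m' (8 * s + 4) = m (8 * s + 4))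
    (hC : ∀ T ∈ C, m' (8 * num N T + 1) = m (8 * num N T + 1)) : Entry N m' s C := by
  unfold Entry
  rw [h1, h2, h4]
  refine ⟨fun T hT => hC T hT ▸ hE.1 T hT, hE.2.imp id ?_⟩
  rintro ⟨T, hT, h⟩
  exact ⟨T, hT, by rw [hC T hT]; exact h⟩

/-- The entries from `q` on refer only to entries with still larger numbers, so variables and
entries below `q` may change freely. -/
theorem Done.congr (ho : SortedItems p o) (hN : N = 2 * n) {m m' : ℕ → ℕ} {q : ℕ}
    (h : Done n N (fun U => pt p (o U)) m q)
    (hm : ∀ a, 8 * q ≤ a → a < 8 * (N * N) → a % 8 ≠ 0 → m' a = m a) :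
    Done n N (fun U => pt p (o U)) m' q := by
  intro T h1 h2 hq
  obtain ⟨hE, hle⟩ := h T h1 h2 hq
  have hlt := num_lt h1 h2
  have e := fun r (hr : 0 < r) (hr' : r < 8) => hm (8 * num N T + r) (by omega) (by omega) (by omega)
  refine ⟨hE.congr (e 1 (by omega) (by omega)) (e 2 (by omega) (by omega))
    (e 4 (by omega) (by omega)) fun T' hT' => ?_, ?_⟩
  · obtain ⟨h3, h4, h5⟩ := successors_spec ho hN h1 h2 le_rfl T' hT'
    have := num_lt h3 h4
    exact hm _ (by omega) (by omega) (by omega)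
  · rw [e 1 (by omega) (by omega)]
    exact hle

theorem Env.congr {m m' : ℕ → ℕ} (h : Env n N o m) (h0 : m' 0 = m 0) (h8 : m' 8 = m 8)
    (hi : ∀ i < N, m' (8 * i + 3) = m (8 * i + 3)) : Env n N o m' :=
  ⟨h0.trans h.n_eq, h8.trans h.N_eq, fun i hiN => (hi i hiN).trans (h.item_eq i hiN)⟩

theorem successors_zero (Q : ℕ → ℝ × ℝ) (s : ℕ × ℕ) : successors n Q s 0 = ∅ :=
  Set.eq_empty_of_forall_notMem fun _ ⟨_, h, _⟩ => absurd h (Nat.not_lt_zero _)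

/-- The value of `m` at the changed address and the invariance elsewhere are all that is known after
an assignment. -/
theorem wp_setVar {k v : ℕ} {e : Expr} {m : ℕ → ℕ} {P : (ℕ → ℕ) → Prop} (hk : 8 * k < M)
    (he : e.Safe M m) (hv : e.eval m = v)
    (h : ∀ m', m' (8 * k) = v → (∀ a, a ≠ 8 * k → m' a = m a) → P m') :
    WP p M (setVar k e) (setVar k e).cost m P := by
  refine wp_assign hk he (h _ ?_ ?_)
  · simp [Expr.eval, hv]
  · intro a ha
    exact Function.update_of_ne ha _ _

theorem wp_newEntry {m : ℕ → ℕ} {s : ℕ} {e : Expr} {P : (ℕ → ℕ) → Prop}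
    (hM : 8 * (N * N) + n + 300 ≤ M) (he : e.Safe M m) (hs : e.eval m = s) (hsN : s ≤ N * N)
    (h : ∀ m', m' 64 = s → m' 56 = 0 → Entry N m' s ∅ →
      (∀ a, a ≠ 56 → a ≠ 64 → a ≠ 8 * s + 1 → a ≠ 8 * s + 2 → a ≠ 8 * s + 4 → m' a = m a) →
      P m') :
    WP p M (newEntry e) (newEntry e).cost m P := by
  refine wp_seq (wp_setVar (by omega) he hs fun m1 h1 h1' => ?_)
  refine wp_seq (wp_assign ?_ ?_ (wp_seq (wp_assign ?_ ?_ (wp_seq (wp_assign ?_ ?_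
    (wp_assign ?_ ?_ (h _ ?_ ?_ ?_ ?_)))))))
  all_goals
    simp (disch := omega) only [Expr.Safe, Expr.eval, addr, var, Function.update_of_ne, h1,
      Nat.reduceMul]
  any_goals omega
  · simp
  · refine ⟨fun T hT => absurd hT (Set.notMem_empty T), Or.inl ?_⟩
    simp (disch := omega) [Function.update_of_ne]
  · intro a h56 h64 ha1 ha2 ha4
    simp (disch := omega) only [Function.update_of_ne]
    exact h1' a h64

theorem wp_itemLoop (ho : SortedItems p o) (hN : N = 2 * n) (hM : 8 * (N * N) + n + 300 ≤ M)
    {m : ℕ → ℕ} (hm : Env n N o m) {U V s : ℕ} (h5 : m 40 = U) (h6 : m 48 = V) (h7 : m 56 = 0)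
    (h8 : m 64 = s) (hU : U < N) (hV : V < N) (hs : s = num N (U, V))
    (hD : Done n N (fun U => pt p (o U)) m (s + 1)) (hE : Entry N m s ∅) :
    WP p M itemLoop ((N + 1) * 1000) m fun m' =>
      Env n N o m' ∧ m' 40 = U ∧ m' 48 = V ∧ Done n N (fun U => pt p (o U)) m' s := by
  have hNM : N ≤ N * N := Nat.le_mul_self N
  have hsN : s < N * N := hs ▸ num_lt (T := (U, V)) hU hV
  have key := wp_loop (p := p) (M := M) (b := .lt (var 7) (var 1))
    (c := .seq tryItem (setVar 7 (.add (var 7) (.const 1))))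
    (τ := tryItem.cost + (setVar 7 (.add (var 7) (.const 1))).cost)
    (fun k m => k ≤ N ∧ Env n N o m ∧ m 40 = U ∧ m 48 = V ∧ m 56 = N - k ∧ m 64 = s ∧
      Done n N (fun U => pt p (o U)) m (s + 1) ∧
      Entry N m s (successors n (fun U => pt p (o U)) (U, V) (N - k))) ?_ ?_ N m
    ⟨le_rfl, hm, h5, h6, by omega, h8, hD, by rwa [Nat.sub_self, successors_zero]⟩
  · refine key.mono ?_ ?_
    -- The cost of one round is a numeral that `decide` bounds by 1000; the extra round in `N + 1`
    -- pays for the final failing test.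
    · have : (Test.lt (var 7) (var 1)).cost +
        (tryItem.cost + (setVar 7 (.add (var 7) (.const 1))).cost) ≤ 1000 := by decide
      have h' := Nat.mul_le_mul_left N this
      have : (Test.lt (var 7) (var 1)).cost ≤ 1000 := by decide
      omega
    · rintro m' ⟨-, hm', h5', h6', -, -, hD', hE'⟩
      refine ⟨hm', h5', h6', fun T h1 h2 hq => ?_⟩
      rcases hq.eq_or_lt with hq | hq
      · have hT : T = (U, V) := num_injective h2 hV (hq.symm.trans hs)
        subst hT
        rw [← hs]
        refine ⟨hE', hE'.le fun T hT => ?_⟩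
        obtain ⟨h3, h4, h5⟩ := successors_spec ho hN h1 h2 le_rfl T hT
        rw [← hs] at h5
        exact ⟨h5, num_lt h3 h4, (hD' T h3 h4 h5).2⟩
      · exact hD' T h1 h2 hq
  · rintro m ⟨-, hm, -, -, h7, -⟩
    have := hm.N_eq
    simp only [Test.Safe, Test.eval, Expr.Safe, Expr.eval, var, Nat.reduceMul, this, h7]
    omega
  · rintro k m ⟨hk, hm, h5, h6, h7, h8, hD, hE⟩
    have h1 := hm.N_eq
    refine ⟨?_, ?_, wp_seq ?_⟩
    · simp only [Test.Safe, Expr.Safe, Expr.eval, var, Nat.reduceMul, h1, h7]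
      omega
    · simp only [Test.eval, Expr.eval, var, Nat.reduceMul, h1, h7]
      omega
    refine (wp_tryItem ho hN hM hm h5 h6 h7 h8 hU hV (by omega) hs
      (fun T h1 h2 h3 => (hD T h1 h2 h3).2) hE).mono le_rfl fun m1 ⟨hE1, hf1⟩ => ?_
    have h7' : m1 56 = N - (k + 1) := by rw [hf1 _ (by omega) (by omega) (by omega), h7]
    refine wp_setVar (v := N - k) (by omega) ?_ ?_ fun m2 h2 h2' => ?_
    · simp only [Expr.Safe, Expr.eval, var, Nat.reduceMul, h7']
      omega
    · simp only [Expr.eval, var, Nat.reduceMul, h7']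
      omega
    · have hm1 := hm.frame hf1
      refine ⟨by omega, hm1.congr (h2' _ (by omega)) (h2' _ (by omega))
        fun i hi => h2' _ (by omega), ?_, ?_, h2, ?_, ?_, ?_⟩
      · rw [h2' _ (by omega), hf1 _ (by omega) (by omega) (by omega), h5]
      · rw [h2' _ (by omega), hf1 _ (by omega) (by omega) (by omega), h6]
      · rw [h2' _ (by omega), hf1 _ (by omega) (by omega) (by omega), h8]
      · refine hD.congr ho hN fun a ha _ ha' => ?_
        rw [h2' _ (by omega), hf1 _ (by omega) (by omega) (by omega)]
      · rw [show N - k = N - (k + 1) + 1 by omega]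
        exact hE1.congr (h2' _ (by omega)) (h2' _ (by omega)) (h2' _ (by omega))
          fun T _ => h2' _ (by omega)

/-- The column is decremented before it is treated, so with `k` rounds left exactly the states from
`U * N + k` on are finished. -/
theorem wp_rowLoop (ho : SortedItems p o) (hN : N = 2 * n) (hM : 8 * (N * N) + n + 300 ≤ M)
    {m : ℕ → ℕ} (hm : Env n N o m) {U : ℕ} (h5 : m 40 = U) (h6 : m 48 = N) (hU : U < N)
    (hD : Done n N (fun U => pt p (o U)) m ((U + 1) * N)) :
    WP p M rowLoop ((N + 1) * ((N + 1) * 1100)) m fun m' =>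
      Env n N o m' ∧ m' 40 = U ∧ Done n N (fun U => pt p (o U)) m' (U * N) := by
  have hNM : N ≤ N * N := Nat.le_mul_self N
  have key := wp_loop (p := p) (M := M) (b := .lt (.const 0) (var 6))
    (c := .seq (setVar 6 (.sub (var 6) (.const 1))) (.seq (newEntry (stateNo 5 6)) itemLoop))
    (τ := (setVar 6 (.sub (var 6) (.const 1))).cost + ((newEntry (stateNo 5 6)).cost +
      (N + 1) * 1000))
    (fun k m => k ≤ N ∧ Env n N o m ∧ m 40 = U ∧ m 48 = k ∧
      Done n N (fun U => pt p (o U)) m (U * N + k)) ?_ ?_ N m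
    ⟨le_rfl, hm, h5, h6, by rwa [Nat.add_mul, Nat.one_mul] at hD⟩
  · refine key.mono ?_ ?_
    · have : (Test.lt (.const 0) (var 6)).cost + ((setVar 6 (.sub (var 6) (.const 1))).cost +
        (newEntry (stateNo 5 6)).cost) ≤ 100 := by decide
      nlinarith
    · rintro m' ⟨-, hm', h5', -, hD'⟩
      exact ⟨hm', h5', hD'⟩
  · rintro m ⟨-, hm, -, h6, -⟩
    simp only [Test.Safe, Test.eval, Expr.Safe, Expr.eval, var, Nat.reduceMul, h6]
    omega
  · rintro k m ⟨hk, hm, h5, h6, hD⟩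
    have hlt := num_lt (T := (U, k)) hU hk
    simp only [num] at hlt
    refine ⟨?_, ?_, wp_seq ?_⟩
    · simp only [Test.Safe, Expr.Safe, Expr.eval, var, Nat.reduceMul, h6]
      omega
    · simp only [Test.eval, Expr.eval, var, Nat.reduceMul, h6]
      omega
    refine wp_setVar (v := k) (by omega) ?_ ?_ fun m1 h1 h1' => wp_seq ?_
    · simp only [Expr.Safe, Expr.eval, var, Nat.reduceMul, h6]
      omega
    · simp only [Expr.eval, var, Nat.reduceMul, h6]
      omega
    have hm1 : Env n N o m1 := hm.congr (h1' _ (by omega)) (h1' _ (by omega))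
        fun i hi => h1' _ (by omega)
    have h5' : m1 40 = U := by rw [h1' _ (by omega), h5]
    have hn := hm1.N_eq
    refine wp_newEntry (s := U * N + k) hM ?_ ?_ hlt.le fun m2 h8 h7 hE h2 => ?_
    · simp only [stateNo, Expr.Safe, Expr.eval, var, Nat.reduceMul, h1, h5', hn]
      omega
    · simp only [stateNo, Expr.eval, var, Nat.reduceMul, h1, h5', hn]
    have e2 : ∀ a, a ≠ 48 → a ≠ 56 → a ≠ 64 → a ≠ 8 * (U * N + k) + 1 →
        a ≠ 8 * (U * N + k) + 2 → a ≠ 8 * (U * N + k) + 4 → m2 a = m a := by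
      intro a a1 a2 a3 a4 a5 a6
      rw [h2 a a2 a3 a4 a5 a6, h1' a a1]
    refine (wp_itemLoop (V := k) ho hN hM (hm.congr ?_ ?_ ?_) ?_ ?_ h7 h8 hU hk rfl
      (hD.congr ho hN ?_) hE).mono le_rfl fun m3 ⟨h3, h3', h3'', h3d⟩ =>
        ⟨by omega, h3, h3', h3'', h3d⟩
    · exact e2 _ (by omega) (by omega) (by omega) (by omega) (by omega) (by omega)
    · exact e2 _ (by omega) (by omega) (by omega) (by omega) (by omega) (by omega)
    · exact fun i hi => e2 _ (by omega) (by omega) (by omega) (by omega) (by omega) (by omega)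
    · rw [e2 _ (by omega) (by omega) (by omega) (by omega) (by omega) (by omega), h5]
    · rw [h2 _ (by omega) (by omega) (by omega) (by omega) (by omega)]
      exact h1
    · intro a ha _ ha'
      exact e2 _ (by omega) (by omega) (by omega) (by omega) (by omega) (by omega)

theorem wp_stateLoop (ho : SortedItems p o) (hN : N = 2 * n) (hM : 8 * (N * N) + n + 300 ≤ M)
    {m : ℕ → ℕ} (hm : Env n N o m) :
    WP p M stateLoop ((N + 1) * ((N + 1) * ((N + 1) * 1200))) m fun m' =>
      Env n N o m' ∧ Done n N (fun U => pt p (o U)) m' 0 := by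
  have hNM : N ≤ N * N := Nat.le_mul_self N
  have key := wp_loop (p := p) (M := M) (b := .lt (.const 0) (var 5))
    (c := .seq (setVar 5 (.sub (var 5) (.const 1))) (.seq (setVar 6 (var 1)) rowLoop))
    (τ := (setVar 5 (.sub (var 5) (.const 1))).cost + ((setVar 6 (var 1)).cost +
      (N + 1) * ((N + 1) * 1100)))
    (fun k m => k ≤ N ∧ Env n N o m ∧ m 40 = k ∧
      Done n N (fun U => pt p (o U)) m (k * N)) ?_ ?_ N
  · have h1 := hm.N_eq
    refine (wp_seq (wp_setVar (v := N) (by omega) ?_ ?_ fun m1 h1 h1' => (key m1 ⟨le_rfl, ?_, h1,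
      ?_⟩).mono le_rfl ?_)).mono ?_ fun _ h => h
    · simp only [Expr.Safe, Expr.eval, var, Nat.reduceMul, h1]
      omega
    · simp only [Expr.eval, var, Nat.reduceMul, h1]
    · exact hm.congr (h1' _ (by omega)) (h1' _ (by omega)) fun i hi => h1' _ (by omega)
    -- Initially nothing is claimed: no state has a number as large as `N * N`.
    · intro T h2 h3 hq
      exact absurd hq (not_le.2 (num_lt h2 h3))
    · rintro m' ⟨-, hm', -, hD'⟩
      exact ⟨hm', by rwa [Nat.zero_mul] at hD'⟩
    · have : (Test.lt (.const 0) (var 5)).cost + ((setVar 5 (.sub (var 5) (.const 1))).cost +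
        (setVar 6 (var 1)).cost) ≤ 50 := by decide
      have : (setVar 5 (var 1)).cost ≤ 50 := by decide
      nlinarith [Nat.zero_le (N * (N * N))]
  · rintro m ⟨-, hm, h5, -⟩
    simp only [Test.Safe, Test.eval, Expr.Safe, Expr.eval, var, Nat.reduceMul, h5]
    omega
  · rintro k m ⟨hk, hm, h5, hD⟩
    refine ⟨?_, ?_, wp_seq ?_⟩
    · simp only [Test.Safe, Expr.Safe, Expr.eval, var, Nat.reduceMul, h5]
      omega
    · simp only [Test.eval, Expr.eval, var, Nat.reduceMul, h5]
      omega
    have hn := hm.N_eq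
    refine wp_setVar (v := k) (by omega) ?_ ?_ fun m1 h1 h1' => wp_seq ?_
    · simp only [Expr.Safe, Expr.eval, var, Nat.reduceMul, h5]
      omega
    · simp only [Expr.eval, var, Nat.reduceMul, h5]
      omega
    have hn1 : m1 8 = N := by rw [h1' _ (by omega), hn]
    refine wp_setVar (v := N) (by omega) ?_ ?_ fun m2 h2 h2' => ?_
    · simp only [Expr.Safe, Expr.eval, var, Nat.reduceMul, hn1]
      omega
    · simp only [Expr.eval, var, Nat.reduceMul, hn1]
    have e2 : ∀ a, a ≠ 40 → a ≠ 48 → m2 a = m a := fun a a1 a2 => by rw [h2' a a2, h1' a a1]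
    refine (wp_rowLoop (U := k) ho hN hM (hm.congr ?_ ?_ ?_) ?_ h2 hk
      (hD.congr ho hN ?_)).mono le_rfl fun m3 ⟨h3, h3', h3d⟩ => ⟨by omega, h3, h3', h3d⟩
    · exact e2 _ (by omega) (by omega)
    · exact e2 _ (by omega) (by omega)
    · exact fun i hi => e2 _ (by omega) (by omega)
    · rw [h2' _ (by omega)]
      exact h1
    · exact fun a ha _ ha' => e2 _ (by omega) (by omega)

/-- The empty sequence acts as an additional state `N * N` whose successors are the start states;
its value, one more than the best of theirs, also counts the first point. -/
theorem wp_firstLoop (ho : SortedItems p o) (hN : N = 2 * n) (hM : 8 * (N * N) + n + 300 ≤ M)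
    {m : ℕ → ℕ} (hm : Env n N o m) (hD : Done n N (fun U => pt p (o U)) m 0) :
    WP p M firstLoop ((N + 1) * 1000) m fun m' =>
      Env n N o m' ∧ Done n N (fun U => pt p (o U)) m' 0 ∧
      Entry N m' (N * N) {T | ∃ z < n, T = (z, z)} := by
  have hNM : N ≤ N * N := Nat.le_mul_self N
  have key := wp_loop (p := p) (M := M) (b := .lt (var 7) (var 0))
    (c := .seq (relax 7 7) (setVar 7 (.add (var 7) (.const 1))))
    (τ := (relax 7 7).cost + (setVar 7 (.add (var 7) (.const 1))).cost)
    (fun k m => k ≤ n ∧ Env n N o m ∧ m 56 = n - k ∧ m 64 = N * N ∧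
      Done n N (fun U => pt p (o U)) m 0 ∧
      Entry N m (N * N) {T | ∃ z < n - k, T = (z, z)}) ?_ ?_ n
  · have h1 := hm.N_eq
    refine (wp_seq (wp_newEntry (s := N * N) hM ?_ ?_ le_rfl fun m1 h8 h7 hE h1' =>
      (key m1 ⟨le_rfl, ?_, ?_, h8, ?_, ?_⟩).mono le_rfl ?_)).mono ?_ fun _ h => h
    · simp only [Expr.Safe, Expr.eval, var, Nat.reduceMul, h1]
      omega
    · simp only [Expr.eval, var, Nat.reduceMul, h1]
    · exact hm.congr (h1' _ (by omega) (by omega) (by omega) (by omega) (by omega))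
        (h1' _ (by omega) (by omega) (by omega) (by omega) (by omega))
        fun i hi => h1' _ (by omega) (by omega) (by omega) (by omega) (by omega)
    · omega
    · exact hD.congr ho hN fun a _ ha ha' =>
        h1' _ (by omega) (by omega) (by omega) (by omega) (by omega)
    · simpa using hE
    · rintro m' ⟨-, hm', -, -, hD', hE'⟩
      exact ⟨hm', hD', hE'⟩
    · have : (Test.lt (var 7) (var 0)).cost + ((relax 7 7).cost +
        (setVar 7 (.add (var 7) (.const 1))).cost) ≤ 1000 := by decide
      have h' := Nat.mul_le_mul_left n this
      have : (newEntry (.mul (var 1) (var 1))).cost + (Test.lt (var 7) (var 0)).cost ≤ 1000 := by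
        decide
      omega
  · rintro m ⟨-, hm, h7, -⟩
    have := hm.n_eq
    simp only [Test.Safe, Test.eval, Expr.Safe, Expr.eval, var, Nat.reduceMul, this, h7]
    omega
  · rintro k m ⟨hk, hm, h7, h8, hD, hE⟩
    have h0 := hm.n_eq
    refine ⟨?_, ?_, wp_seq ?_⟩
    · simp only [Test.Safe, Expr.Safe, Expr.eval, var, Nat.reduceMul, h0, h7]
      omega
    · simp only [Test.eval, Expr.eval, var, Nat.reduceMul, h0, h7]
      omega
    have hlt : ∀ z < n, num N (z, z) < N * N ∧ m (8 * num N (z, z) + 1) ≤ N * N := fun z hz =>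
      ⟨num_lt (by simp only; omega) (by simp only; omega),
        ((hD (z, z) (by simp only; omega) (by simp only; omega) (Nat.zero_le _)).2).trans
          (Nat.sub_le _ _)⟩
    have hFle : m (8 * (N * N) + 1) ≤ N * N + 1 := by
      rcases hE.2 with h | ⟨_, ⟨z, hz, rfl⟩, h, -⟩
      · omega
      · have := hlt z (by omega)
        omega
    have hz := hlt (n - (k + 1)) (by omega)
    refine (wp_relax hM (by omega) (by omega) hm.N_eq h8 h7 h7 (by omega) (by omega) le_rfl
      hFle hz.2 hE ?_ hz.1.ne).mono le_rfl fun m1 ⟨hE1, hf1⟩ => ?_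
    · rintro _ ⟨z, hz, rfl⟩
      exact (hlt z (by omega)).1.ne
    have h7' : m1 56 = n - (k + 1) := by rw [hf1 _ (by omega) (by omega) (by omega), h7]
    refine wp_setVar (v := n - k) (by omega) ?_ ?_ fun m2 h2 h2' => ?_
    · simp only [Expr.Safe, Expr.eval, var, Nat.reduceMul, h7']
      omega
    · simp only [Expr.eval, var, Nat.reduceMul, h7']
      omega
    · have hm1 := hm.frame hf1
      refine ⟨by omega, hm1.congr (h2' _ (by omega)) (h2' _ (by omega))
        fun i hi => h2' _ (by omega), h2, ?_, ?_, ?_⟩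
      · rw [h2' _ (by omega), hf1 _ (by omega) (by omega) (by omega), h8]
      · refine hD.congr ho hN fun a _ ha ha' => ?_
        rw [h2' _ (by omega), hf1 _ (by omega) (by omega) (by omega)]
      · refine Entry.congr ?_ (h2' _ (by omega)) (h2' _ (by omega)) (h2' _ (by omega))
          fun T _ => h2' _ (by omega)
        convert hE1 using 1
        ext T
        simp only [Set.mem_ofPred_eq, Set.mem_insert_iff]
        constructor
        · rintro ⟨z, hz, rfl⟩
          rcases (show z ≤ n - (k + 1) by omega).eq_or_lt with rfl | h
          · exact Or.inl rfl
          · exact Or.inr ⟨z, h, rfl⟩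
        · rintro (rfl | ⟨z, hz, rfl⟩)
          · exact ⟨_, by omega, rfl⟩
          · exact ⟨z, by omega, rfl⟩

/-! ### Sorting by counting ranks -/

/-- The number of points to the left of the point with index `i` among the first `k` ones. -/
noncomputable def rank (p : Fin n → ℝ × ℝ) (i k : ℕ) : ℕ :=
  ((Finset.range k).filter fun j => (pt p j).1 < (pt p i).1).card

theorem rank_succ (i k : ℕ) :
    rank p i (k + 1) = rank p i k + if (pt p k).1 < (pt p i).1 then 1 else 0 := by
  unfold rank
  rw [Finset.range_add_one, Finset.filter_insert]
  split_ifs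
  · rw [Finset.card_insert_of_notMem (by simp)]
  · simp

theorem rank_le (i k : ℕ) : rank p i k ≤ k :=
  (Finset.card_filter_le _ _).trans (Finset.card_range k).le

theorem rank_lt_rank {i j : ℕ} (hi : i < n) (h : (pt p i).1 < (pt p j).1) :
    rank p i n < rank p j n := by
  refine Finset.card_lt_card ((Finset.ssubset_iff_of_subset ?_).2 ⟨i, ?_, ?_⟩)
  · intro k hk
    rw [Finset.mem_filter] at hk ⊢
    exact ⟨hk.1, hk.2.trans h⟩
  · simpa using ⟨hi, h⟩
  · simp

theorem rank_lt {i : ℕ} (hi : i < n) : rank p i n < n := by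
  conv_rhs => rw [← Finset.card_range n]
  refine Finset.card_lt_card ((Finset.ssubset_iff_of_subset (Finset.filter_subset _ _)).2 ⟨i, ?_, ?_⟩)
  · simpa using hi
  · simp

theorem rank_injective (hp : GeneralPosition p) {i j : ℕ} (hi : i < n) (hj : j < n)
    (h : rank p i n = rank p j n) : i = j := by
  rcases lt_trichotomy (pt p i).1 (pt p j).1 with hlt | heq | hlt
  · exact absurd h (rank_lt_rank hi hlt).ne
  · rw [pt_of_lt p hi, pt_of_lt p hj] at heq
    exact congrArg Fin.val (hp.1 heq)
  · exact absurd h (rank_lt_rank hj hlt).ne'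

/-- The rank is an injective map of `n` indices into `n` values, hence onto. -/
theorem exists_rank_eq (hp : GeneralPosition p) {k : ℕ} (hk : k < n) :
    ∃ i < n, rank p i n = k := by
  have := Finset.surjOn_of_injOn_of_card_le (s := Finset.range n) (t := Finset.range n)
    (fun i => rank p i n) (fun i hi => by simpa using rank_lt (by simpa using hi))
    (fun i hi j hj h => rank_injective hp (by simpa using hi) (by simpa using hj) h) le_rfl
  obtain ⟨i, hi, h⟩ := this (show k ∈ (Finset.range n : Set ℕ) by simpa using hk)
  exact ⟨i, by simpa using hi, h⟩

theorem sortedItems_of_rank (hp : GeneralPosition p)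
    (h : ∀ i < n, o (rank p i n) = i ∧ o (n + rank p i n) = i) : SortedItems p o where
  lt U hU := by
    rcases lt_or_ge U n with h1 | h1
    · obtain ⟨i, hi, rfl⟩ := exists_rank_eq hp h1
      rw [(h i hi).1]
      exact hi
    · obtain ⟨k, rfl⟩ := Nat.exists_eq_add_of_le h1
      obtain ⟨i, hi, rfl⟩ := exists_rank_eq hp (show k < n by omega)
      rw [(h i hi).2]
      exact hi
  shift k hk := by
    obtain ⟨i, hi, rfl⟩ := exists_rank_eq hp hk
    rw [(h i hi).1, (h i hi).2]
  mono a b hab hb := by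
    obtain ⟨i, hi, rfl⟩ := exists_rank_eq hp (hab.trans hb)
    obtain ⟨j, hj, rfl⟩ := exists_rank_eq hp hb
    rw [(h i hi).1, (h j hj).1]
    by_contra hc
    rcases (not_lt.1 hc).eq_or_lt with heq | hlt
    · rw [pt_of_lt p hi, pt_of_lt p hj] at heq
      have := congrArg Fin.val (hp.1 heq)
      simp only at this
      subst this
      exact lt_irrefl _ hab
    · exact lt_asymm hab (rank_lt_rank hj hlt)
  surj i hi := ⟨rank p i n, rank_lt hi, (h i hi).1⟩

/-- Add the number of points to the left of the point in the variable `2` to the variable `4`. -/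
def rankLoop : Prog :=
  .loop (.lt (var 3) (var 0))
    (.seq (.ite (.xlt (var 3) (var 2)) (setVar 4 (.add (var 4) (.const 1))) .skip)
      (setVar 3 (.add (var 3) (.const 1))))

/-- Sort the points from left to right. -/
def sortLoop : Prog :=
  .seq (setVar 1 (.add (var 0) (var 0))) (.seq (setVar 2 (.const 0))
    (.loop (.lt (var 2) (var 0))
      (.seq (setVar 4 (.const 0)) (.seq (setVar 3 (.const 0)) (.seq rankLoop
        (.seq (.assign (addr 3 (var 4)) (var 2))
          (.seq (.assign (addr 3 (.add (var 4) (var 0))) (var 2))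
            (setVar 2 (.add (var 2) (.const 1))))))))))

theorem wp_rankLoop (hM : n + 300 ≤ M) {m : ℕ → ℕ} {i : ℕ} (h0 : m 0 = n) (h2 : m 16 = i)
    (h3 : m 24 = 0) (h4 : m 32 = 0) (hi : i < n) :
    WP p M rankLoop ((n + 1) * 100) m fun m' =>
      m' 32 = rank p i n ∧ ∀ a, a ≠ 24 → a ≠ 32 → m' a = m a := by
  have key := wp_loop (p := p) (M := M) (b := .lt (var 3) (var 0))
    (c := .seq (.ite (.xlt (var 3) (var 2)) (setVar 4 (.add (var 4) (.const 1))) .skip)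
      (setVar 3 (.add (var 3) (.const 1))))
    (τ := (Prog.ite (.xlt (var 3) (var 2)) (setVar 4 (.add (var 4) (.const 1))) .skip).cost +
      (setVar 3 (.add (var 3) (.const 1))).cost)
    (fun k m' => k ≤ n ∧ m' 24 = n - k ∧ m' 32 = rank p i (n - k) ∧
      ∀ a, a ≠ 24 → a ≠ 32 → m' a = m a) ?_ ?_ n m
    ⟨le_rfl, by omega, by simp [h4, rank], fun _ _ _ => rfl⟩
  · refine key.mono ?_ fun m' h => h.2.2
    have : (Test.lt (var 3) (var 0)).cost +
      ((Prog.ite (.xlt (var 3) (var 2)) (setVar 4 (.add (var 4) (.const 1))) .skip).cost +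
      (setVar 3 (.add (var 3) (.const 1))).cost) ≤ 100 := by decide
    have h' := Nat.mul_le_mul_left n this
    have : (Test.lt (var 3) (var 0)).cost ≤ 100 := by decide
    omega
  · rintro m' ⟨-, h3', -, hf⟩
    have h0' : m' 0 = n := by rw [hf _ (by omega) (by omega), h0]
    simp only [Test.Safe, Test.eval, Expr.Safe, Expr.eval, var, Nat.reduceMul, h0', h3']
    omega
  · rintro k m' ⟨hk, h3', h4', hf⟩
    have h0' : m' 0 = n := by rw [hf _ (by omega) (by omega), h0]
    have h2' : m' 16 = i := by rw [hf _ (by omega) (by omega), h2]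
    have hr := rank_le (p := p) i (n - (k + 1))
    have e3 : (var 3).eval m' = n - (k + 1) := by simp only [var, Expr.eval, Nat.reduceMul, h3']
    have e2 : (var 2).eval m' = i := by simp only [var, Expr.eval, Nat.reduceMul, h2']
    have ev := @eval_xlt n p m' (var 3) (var 2) (by omega) (by omega)
    rw [e3, e2] at ev
    have hs := rank_succ (p := p) i (n - (k + 1))
    rw [show n - (k + 1) + 1 = n - k by omega] at hs
    have last : ∀ m1, m1 24 = n - (k + 1) → m1 32 = rank p i (n - k) →
        (∀ a, a ≠ 24 → a ≠ 32 → m1 a = m a) →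
        WP p M (setVar 3 (.add (var 3) (.const 1))) (setVar 3 (.add (var 3) (.const 1))).cost m1
          fun m' => k ≤ n ∧ m' 24 = n - k ∧ m' 32 = rank p i (n - k) ∧
            ∀ a, a ≠ 24 → a ≠ 32 → m' a = m a := by
      intro m1 h3'' h4'' hf1
      refine wp_setVar (v := n - k) (by omega) ?_ ?_ fun m2 h2 h2' => ⟨by omega, h2, ?_, ?_⟩
      · simp only [Expr.Safe, Expr.eval, var, Nat.reduceMul, h3'']
        omega
      · simp only [Expr.eval, var, Nat.reduceMul, h3'']
        omega
      · rw [h2' _ (by omega), h4'']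
      · intro a h1 h2
        rw [h2' _ (by omega), hf1 _ h1 h2]
    refine ⟨?_, ?_, wp_seq (wp_ite ?_ (fun h => ?_) (fun h => ?_))⟩
    · simp only [Test.Safe, Expr.Safe, Expr.eval, var, Nat.reduceMul, h0', h3']
      omega
    · simp only [Test.eval, Expr.eval, var, Nat.reduceMul, h0', h3']
      omega
    · simp only [Test.Safe, Expr.Safe, Expr.eval, var, Nat.reduceMul, h2', h3']
      omega
    · rw [ev] at h
      rw [if_pos h] at hs
      refine wp_setVar (v := rank p i (n - k)) (by omega) ?_ ?_ fun m1 h1 h1' => last m1 ?_ h1 ?_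
      · simp only [Expr.Safe, Expr.eval, var, Nat.reduceMul, h4']
        omega
      · simp only [Expr.eval, var, Nat.reduceMul, h4']
        omega
      · rw [h1' _ (by omega), h3']
      · intro a h2 h3
        rw [h1' _ (by omega), hf _ h2 h3]
    · rw [ev] at h
      rw [if_neg h] at hs
      exact wp_skip (last m' h3' (by rw [h4', hs]; rfl) hf)

theorem wp_sortLoop (hp : GeneralPosition p) (hN : N = 2 * n) (hM : 8 * (N * N) + n + 300 ≤ M)
    {m : ℕ → ℕ} (h0 : m 0 = n) :
    WP p M sortLoop ((n + 1) * ((n + 1) * 300)) m fun m' =>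
      ∃ o, SortedItems p o ∧ Env n N o m' := by
  have hNM : N ≤ N * N := Nat.le_mul_self N
  have key := wp_loop (p := p) (M := M) (b := .lt (var 2) (var 0))
    (c := .seq (setVar 4 (.const 0)) (.seq (setVar 3 (.const 0)) (.seq rankLoop
        (.seq (.assign (addr 3 (var 4)) (var 2))
          (.seq (.assign (addr 3 (.add (var 4) (var 0))) (var 2))
            (setVar 2 (.add (var 2) (.const 1))))))))
    (τ := (setVar 4 (.const 0)).cost + ((setVar 3 (.const 0)).cost + ((n + 1) * 100 +
        ((Prog.assign (addr 3 (var 4)) (var 2)).cost +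
          ((Prog.assign (addr 3 (.add (var 4) (var 0))) (var 2)).cost +
            (setVar 2 (.add (var 2) (.const 1))).cost)))))
    (fun k m => k ≤ n ∧ m 0 = n ∧ m 8 = N ∧ m 16 = n - k ∧ ∀ i < n - k,
      m (8 * rank p i n + 3) = i ∧ m (8 * (n + rank p i n) + 3) = i) ?_ ?_ n
  · refine (wp_seq (wp_setVar (v := N) (by omega) ?_ ?_ fun m1 h1 h1' =>
      wp_seq (wp_setVar (v := 0) (by omega) ?_ rfl fun m2 h2 h2' =>
      (key m2 ⟨le_rfl, ?_, ?_, ?_, ?_⟩).mono le_rfl ?_))).mono ?_ fun _ h => h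
    · simp only [Expr.Safe, Expr.eval, var, Nat.mul_zero, h0]
      omega
    · simp only [Expr.eval, var, Nat.mul_zero, h0]
      omega
    · simp only [Expr.Safe]
      omega
    · rw [h2' _ (by omega), h1' _ (by omega), h0]
    · rw [h2' _ (by omega)]
      exact h1
    · rw [show (16 : ℕ) = 8 * 2 from rfl, h2]
      omega
    · omega
    · rintro m' ⟨-, h0', h8, -, hr⟩
      -- The order is read off the final memory.
      exact ⟨fun U => m' (8 * U + 3), sortedItems_of_rank hp (by simpa using hr), h0', h8,
        fun _ _ => rfl⟩
    · have h1 : (setVar 1 (.add (var 0) (var 0))).cost + ((setVar 2 (.const 0)).cost +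
        (Test.lt (var 2) (var 0)).cost) ≤ 100 := by decide
      have h2 : (Test.lt (var 2) (var 0)).cost + ((setVar 4 (.const 0)).cost +
        ((setVar 3 (.const 0)).cost + ((Prog.assign (addr 3 (var 4)) (var 2)).cost +
          ((Prog.assign (addr 3 (.add (var 4) (var 0))) (var 2)).cost +
            (setVar 2 (.add (var 2) (.const 1))).cost)))) ≤ 100 := by decide
      nlinarith
  · rintro m ⟨-, h0, -, h2, -⟩
    simp only [Test.Safe, Test.eval, Expr.Safe, Expr.eval, var, Nat.reduceMul, h0, h2]
    omega
  · rintro k m ⟨hk, h0, h8, h2, hr⟩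
    refine ⟨?_, ?_, wp_seq ?_⟩
    · simp only [Test.Safe, Expr.Safe, Expr.eval, var, Nat.reduceMul, h0, h2]
      omega
    · simp only [Test.eval, Expr.eval, var, Nat.reduceMul, h0, h2]
      omega
    have hi : n - (k + 1) < n := by omega
    have hlt := rank_lt (p := p) hi
    refine wp_setVar (v := 0) (by omega) (by simp only [Expr.Safe]; omega) rfl fun m1 e1 f1 =>
      wp_seq (wp_setVar (v := 0) (by omega) (by simp only [Expr.Safe]; omega) rfl fun m2 e2 f2 =>
      wp_seq ((wp_rankLoop (i := n - (k + 1)) (by omega) ?_ ?_ e2 ?_ hi).mono le_rfl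
      fun m3 ⟨e3, f3⟩ => ?_))
    · rw [f2 _ (by omega), f1 _ (by omega), h0]
    · rw [f2 _ (by omega), f1 _ (by omega), h2]
    · rw [f2 _ (by omega)]
      exact e1
    have f : ∀ a, a ≠ 24 → a ≠ 32 → m3 a = m a := fun a a1 a2 => by
      rw [f3 a a1 a2, f2 a a1, f1 a a2]
    have h2' : m3 16 = n - (k + 1) := by rw [f _ (by omega) (by omega), h2]
    have h0' : m3 0 = n := by rw [f _ (by omega) (by omega), h0]
    refine wp_seq (wp_assign ?_ ?_ (wp_seq (wp_assign ?_ ?_ (wp_setVar (v := n - k) (by omega) ?_ ?_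
      fun m4 e4 f4 => ⟨by omega, ?_, ?_, e4, ?_⟩))))
    all_goals
      try simp (disch := omega) only [Expr.eval, addr, var, Function.update_of_ne, h0', h2',
        e3, Nat.reduceMul, Nat.mul_zero] at f4
    all_goals
      try simp (disch := omega) only [Expr.Safe, Expr.eval, addr, var, Function.update_of_ne, h0',
        h2', e3, Nat.reduceMul, Nat.mul_zero]
    any_goals omega
    · rw [f4 _ (by omega)]
      simp (disch := omega) only [Function.update_of_ne, h0']
    · rw [f4 _ (by omega)]
      simp (disch := omega) only [Function.update_of_ne]
      rw [f _ (by omega) (by omega), h8]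
    · intro i hik
      rw [f4 _ (by omega), f4 _ (by omega)]
      rcases (show i ≤ n - (k + 1) by omega).eq_or_lt with rfl | hik'
      · constructor
        · simp (disch := omega) [Function.update_of_ne]
        · rw [Nat.add_comm n]
          simp
      -- Ranks are distinct and less than `n`, so the two new writes hit neither the early nor the
      -- late cell of an earlier point.
      · have hne : rank p i n ≠ rank p (n - (k + 1)) n := fun h => by
          have := rank_injective hp (by omega) hi h
          omega
        have hlt' := rank_lt (p := p) (show i < n by omega)
        simp (disch := omega) only [Function.update_of_ne]
        rw [f _ (by omega) (by omega), f _ (by omega) (by omega)]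
        exact hr i hik'

/-! ### Optimality of the table and output of an optimal sequence -/

theorem length_le_of_accepts (ho : SortedItems p o) (hN : N = 2 * n) {m : ℕ → ℕ}
    (hD : Done n N (fun U => pt p (o U)) m 0) {T : ℕ × ℕ} (h1 : T.1 < N) (h2 : T.2 < N)
    {r : List (Bool × ℕ)} (hr : Accepts n (fun U => pt p (o U)) T r) (hlt : ∀ w ∈ r, w.2 < N) :
    r.length ≤ m (8 * num N T + 1) := by
  induction r generalizing T with
  | nil => exact Nat.zero_le _
  | cons w r ih =>
    rw [List.forall_mem_cons] at hlt
    obtain ⟨h3, h4, -⟩ := num_upd ho hN h1 h2 hlt.1 hr.1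
    have h5 := ih h3 h4 hr.2 hlt.2
    have h6 := (hD T h1 h2 (Nat.zero_le _)).1.1 _ ⟨w, hlt.1, hr.1, rfl⟩
    rw [List.length_cons]
    omega

/-- Starting from the state `T`, the successors stored in the table are those that arise by
appending the labelled items of the list. -/
def Trace (n N : ℕ) (Q : ℕ → ℝ × ℝ) (m : ℕ → ℕ) : ℕ × ℕ → List (Bool × ℕ) → Prop
  | T, [] => m (8 * num N T + 2) = 0 ∧ m (8 * num N T + 4) = 0
  | T, w :: r => w.2 < N ∧ Ok n Q T w ∧ m (8 * num N T + 2) = (upd T w).1 + 1 ∧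
      m (8 * num N T + 4) = (upd T w).2 ∧ Trace n N Q m (upd T w) r

/-- The stored successor has a value smaller by exactly one. A state of value 0 has no stored
successor, and its zero in column 2 is what stops the walk. -/
theorem exists_trace (ho : SortedItems p o) (hN : N = 2 * n) {m : ℕ → ℕ}
    (hD : Done n N (fun U => pt p (o U)) m 0) (k : ℕ) {T : ℕ × ℕ} (h1 : T.1 < N) (h2 : T.2 < N)
    (hk : m (8 * num N T + 1) = k) : ∃ r, Trace n N (fun U => pt p (o U)) m T r ∧ r.length = k := by
  induction k generalizing T with
  | zero =>
    rcases (hD T h1 h2 (Nat.zero_le _)).1.2 with h | ⟨_, -, h, -⟩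
    · exact ⟨[], ⟨h.2.1, h.2.2⟩, rfl⟩
    · omega
  | succ k ih =>
    rcases (hD T h1 h2 (Nat.zero_le _)).1.2 with h | ⟨_, ⟨w, hw, hok, rfl⟩, h, h'⟩
    · omega
    · obtain ⟨h3, h4, -⟩ := num_upd ho hN h1 h2 hw hok
      obtain ⟨r, hr, hlen⟩ := ih h3 h4 (by omega)
      exact ⟨w :: r, ⟨hw, hok, h'.1, h'.2, hr⟩, by simp [hlen]⟩

theorem Trace.accepts {Q : ℕ → ℝ × ℝ} {m : ℕ → ℕ} {T : ℕ × ℕ} {r : List (Bool × ℕ)}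
    (h : Trace n N Q m T r) : Accepts n Q T r ∧ ∀ w ∈ r, w.2 < N := by
  induction r generalizing T with
  | nil => exact ⟨trivial, by simp⟩
  | cons w r ih =>
    obtain ⟨hw, hok, -, -, hr⟩ := h
    exact ⟨⟨hok, (ih hr).1⟩, List.forall_mem_cons.2 ⟨hw, (ih hr).2⟩⟩

/-- The address of the output array. -/
def outBase : Expr := .add (.mul (.const 8) (.mul (var 1) (var 1))) (.const 200)

/-- Clear the output array. -/
def clearLoop : Prog :=
  .seq (setVar 2 (.const 0)) (.loop (.lt (var 2) (var 0))
    (.seq (.assign (.add outBase (var 2)) (.const 0)) (setVar 2 (.add (var 2) (.const 1)))))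

/-- Load the successor of the state with number in the variable `8`. -/
def load : Prog :=
  .seq (setVar 5 (.cell (addr 2 (var 8)))) (setVar 6 (.cell (addr 4 (var 8))))

/-- Write the points of a labelled sequence of maximum length to the output array. -/
def walkLoop : Prog :=
  .seq (setVar 8 (.mul (var 1) (var 1))) (.seq load (.loop (.lt (.const 0) (var 5))
    (.seq (.assign (.add outBase (.cell (addr 3 (.sub (var 5) (.const 1))))) (.const 1))
      (.seq (.assign (.add outBase (item 6)) (.const 1))
        (.seq (setVar 8 (.add (.mul (.sub (var 5) (.const 1)) (var 1)) (var 6))) load)))))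

/-- The program that solves MaxRCH. -/
def program : Prog :=
  .seq sortLoop (.seq stateLoop (.seq firstLoop (.seq clearLoop (.seq walkLoop
    (setVar 0 outBase)))))

/-- The specifications of the previous phases say nothing about the output cells. The offset 200
places them beyond the table and the variables, even for `N = 0`. -/
theorem wp_clearLoop (hM : 8 * (N * N) + n + 300 ≤ M) {m : ℕ → ℕ} (hm : Env n N o m) :
    WP p M clearLoop ((n + 1) * 100) m fun m' =>
      (∀ a < 8 * (N * N) + 200, a ≠ 16 → m' a = m a) ∧
      ∀ i < n, m' (8 * (N * N) + 200 + i) = 0 := by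
  have hNM : N ≤ N * N := Nat.le_mul_self N
  have key := wp_loop (p := p) (M := M) (b := .lt (var 2) (var 0))
    (c := .seq (.assign (.add outBase (var 2)) (.const 0)) (setVar 2 (.add (var 2) (.const 1))))
    (τ := (Prog.assign (.add outBase (var 2)) (.const 0)).cost +
      (setVar 2 (.add (var 2) (.const 1))).cost)
    (fun k m' => k ≤ n ∧ m' 16 = n - k ∧ (∀ a < 8 * (N * N) + 200, a ≠ 16 → m' a = m a) ∧
      ∀ i < n - k, m' (8 * (N * N) + 200 + i) = 0) ?_ ?_ n
  · refine (wp_seq (wp_setVar (v := 0) (by omega) (by simp only [Expr.Safe]; omega) rfl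
      fun m1 h1 h1' => (key m1 ⟨le_rfl, ?_, fun a _ ha => h1' a ha, ?_⟩).mono le_rfl ?_)).mono ?_
      fun _ h => h
    · rw [Nat.sub_self]
      exact h1
    · omega
    · rintro m' ⟨-, -, h3, h4⟩
      exact ⟨h3, h4⟩
    · have : (Test.lt (var 2) (var 0)).cost +
        ((Prog.assign (.add outBase (var 2)) (.const 0)).cost +
        (setVar 2 (.add (var 2) (.const 1))).cost) ≤ 100 := by decide
      have h' := Nat.mul_le_mul_left n this
      have : (setVar 2 (.const 0)).cost + (Test.lt (var 2) (var 0)).cost ≤ 100 := by decide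
      omega
  · rintro m' ⟨-, h2, hf, -⟩
    have h0 : m' 0 = n := by rw [hf _ (by omega) (by omega), hm.n_eq]
    simp only [Test.Safe, Test.eval, Expr.Safe, Expr.eval, var, Nat.reduceMul, h0, h2]
    omega
  · rintro k m' ⟨hk, h2, hf, hz⟩
    have h0 : m' 0 = n := by rw [hf _ (by omega) (by omega), hm.n_eq]
    have h8 : m' 8 = N := by rw [hf _ (by omega) (by omega), hm.N_eq]
    refine ⟨?_, ?_, wp_seq (wp_assign ?_ ?_ (wp_setVar (v := n - k) (by omega) ?_ ?_
      fun m1 e1 f1 => ⟨by omega, e1, ?_, ?_⟩))⟩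
    · simp only [Test.Safe, Expr.Safe, Expr.eval, var, Nat.reduceMul, h0, h2]
      omega
    · simp only [Test.eval, Expr.eval, var, Nat.reduceMul, h0, h2]
      omega
    all_goals
      try simp only [Expr.eval, outBase, var, h8, h2, Nat.reduceMul] at f1
    all_goals
      try simp (disch := omega) only [Expr.Safe, Expr.eval, outBase, var, Function.update_of_ne, h8,
        h2, Nat.reduceMul]
    any_goals omega
    · intro a ha ha'
      rw [f1 _ ha']
      simp (disch := omega) only [Function.update_of_ne]
      exact hf a ha ha'
    · intro i hi
      rw [f1 _ (by omega)]
      rcases (show i ≤ n - (k + 1) by omega).eq_or_lt with rfl | hi'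
      · simp
      · simp (disch := omega) only [Function.update_of_ne]
        exact hz i hi'

theorem wp_load (hM : 8 * (N * N) + n + 300 ≤ M) {m : ℕ → ℕ} {s : ℕ} (h8 : m 64 = s)
    (hs : s ≤ N * N) (h2 : m (8 * s + 2) ≤ N) (h4 : m (8 * s + 4) ≤ N) {P : (ℕ → ℕ) → Prop}
    (h : ∀ m', m' 40 = m (8 * s + 2) → m' 48 = m (8 * s + 4) →
      (∀ a, a ≠ 40 → a ≠ 48 → m' a = m a) → P m') :
    WP p M load load.cost m P := by
  have hNM : N ≤ N * N := Nat.le_mul_self N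
  refine wp_seq (wp_setVar (v := m (8 * s + 2)) (by omega) ?_ ?_ fun m1 e1 f1 =>
    wp_setVar (v := m (8 * s + 4)) (by omega) ?_ ?_ fun m2 e2 f2 => h m2 ?_ e2 ?_)
  · simp only [Expr.Safe, Expr.eval, addr, var, Nat.reduceMul, h8]
    omega
  · simp only [Expr.eval, addr, var, Nat.reduceMul, h8]
  · have h8' : m1 64 = s := by rw [f1 _ (by omega), h8]
    have h4' := f1 (8 * s + 4) (by omega)
    simp only [Expr.Safe, Expr.eval, addr, var, Nat.reduceMul, h8']
    omega
  · have h8' : m1 64 = s := by rw [f1 _ (by omega), h8]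
    simp only [Expr.eval, addr, var, Nat.reduceMul, h8']
    exact f1 _ (by omega)
  · rw [f2 _ (by omega)]
    exact e1
  · intro a h5 h6
    rw [f2 a h6, f1 a h5]

theorem wp_walkLoop (ho : SortedItems p o) (hN : N = 2 * n) (hM : 8 * (N * N) + n + 300 ≤ M)
    {m : ℕ → ℕ} (hm : Env n N o m) (hD : Done n N (fun U => pt p (o U)) m 0)
    (hE : Entry N m (N * N) {T | ∃ z < n, T = (z, z)})
    (hz : ∀ i < n, m (8 * (N * N) + 200 + i) = 0) :
    WP p M walkLoop ((N * N + 1) * 200) m fun m' =>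
      Env n N o m' ∧ (m (8 * (N * N) + 1) = 0 ∨ ∃ z < n, ∃ r : List (Bool × ℕ),
        Accepts n (fun U => pt p (o U)) (z, z) r ∧ (∀ w ∈ r, w.2 < N) ∧
        m (8 * (N * N) + 1) = r.length + 1 ∧
        ∀ i < n, m' (8 * (N * N) + 200 + i) ≠ 0 ↔ ∃ w ∈ (true, z) :: r, o w.2 = i) := by
  have hNM : N ≤ N * N := Nat.le_mul_self N
  have key := fun G : ℕ → Prop => wp_loop (p := p) (M := M) (b := .lt (.const 0) (var 5))
    (c := .seq (.assign (.add outBase (.cell (addr 3 (.sub (var 5) (.const 1))))) (.const 1))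
      (.seq (.assign (.add outBase (item 6)) (.const 1))
        (.seq (setVar 8 (.add (.mul (.sub (var 5) (.const 1)) (var 1)) (var 6))) load)))
    (τ := (Prog.assign (.add outBase (.cell (addr 3 (.sub (var 5) (.const 1))))) (.const 1)).cost +
      ((Prog.assign (.add outBase (item 6)) (.const 1)).cost +
        ((setVar 8 (.add (.mul (.sub (var 5) (.const 1)) (var 1)) (var 6))).cost + load.cost)))
    -- `G` is the final set of marks: at every moment it consists of the marks made, the two items
    -- of the current state and the items still to be appended.
    (fun k m' => (∀ a < 8 * (N * N) + 200, a ≠ 40 → a ≠ 48 → a ≠ 64 → m' a = m a) ∧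
      ((k = 0 ∧ m' 40 = 0 ∧ ∀ i < n, m' (8 * (N * N) + 200 + i) ≠ 0 ↔ G i) ∨
      ∃ T r, k = r.length + 1 ∧ T.1 < N ∧ T.2 < N ∧ Trace n N (fun U => pt p (o U)) m T r ∧
        m' 40 = T.1 + 1 ∧ m' 48 = T.2 ∧ ∀ i < n, (m' (8 * (N * N) + 200 + i) ≠ 0 ∨ o T.1 = i ∨
          o T.2 = i ∨ ∃ w ∈ r, o w.2 = i) ↔ G i)) ?_ ?_
  · have hlt : ∀ z < n, num N (z, z) < N * N := fun z hz =>
      num_lt (by simp only; omega) (by simp only; omega)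
    have h1 := hm.N_eq
    refine WP.mono (wp_seq
      (wp_setVar (v := N * N) (by omega) ?_ ?_ fun m1 e1 f1 => wp_seq
      (wp_load hM e1 le_rfl ?_ ?_ fun m2 e2 e3 f2 => ?_))) (u := (N * N + 1) * 200)
      (t := (setVar 8 (.mul (var 1) (var 1))).cost + (load.cost + ((N * N + 1) * 74 + 10))) ?_
      fun _ h => h
    · simp only [Expr.Safe, Expr.eval, var, Nat.reduceMul, h1]
      omega
    · simp only [Expr.eval, var, Nat.reduceMul, h1]
    · rw [f1 _ (by omega)]
      rcases hE.2 with h | ⟨_, ⟨z, hz, rfl⟩, -, h, -⟩ <;> omega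
    · rw [f1 _ (by omega)]
      rcases hE.2 with h | ⟨_, ⟨z, hz, rfl⟩, -, -, h⟩ <;> omega
    · have hf : ∀ a, a ≠ 40 → a ≠ 48 → a ≠ 64 → m2 a = m a := fun a a1 a2 a3 => by
        rw [f2 a a1 a2, f1 a a3]
      have env : ∀ m', (∀ a < 8 * (N * N) + 200, a ≠ 40 → a ≠ 48 → a ≠ 64 → m' a = m a) →
          Env n N o m' := fun m' hf => hm.congr (hf _ (by omega) (by omega) (by omega) (by omega))
        (hf _ (by omega) (by omega) (by omega) (by omega))
        fun i hi => hf _ (by omega) (by omega) (by omega) (by omega)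
      rw [f1 _ (by omega)] at e2 e3
      have hcost : (Test.lt (.const 0) (var 5)).cost ≤ 10 := by decide
      rcases hE.2 with h | ⟨_, ⟨z, hz', rfl⟩, hF, h, h'⟩
      · refine (key (fun _ => False) 0 m2 ⟨fun a _ => hf a, Or.inl ⟨rfl, by rw [e2, h.2.1],
          fun i hi => ?_⟩⟩).mono (by omega) ?_
        · rw [hf _ (by omega) (by omega) (by omega), hz i hi]
          simp
        · exact fun m' h' => ⟨env m' h'.1, Or.inl h.1⟩
      · obtain ⟨r, hr, hlen⟩ := exists_trace ho hN hD _ (T := (z, z)) (by simp only; omega)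
          (by simp only; omega) rfl
        -- The general bound on table values limits the number of rounds to `N * N + 1`, which is
        -- enough for cubic time.
        have hle := (hD (z, z) (by simp only; omega) (by simp only; omega) (Nat.zero_le _)).2
        refine (key (fun i => ∃ w ∈ (true, z) :: r, o w.2 = i) (r.length + 1) m2 ⟨fun a _ => hf a,
          Or.inr ⟨(z, z), r, rfl, by simp only; omega, by simp only; omega, hr, by rw [e2, h],
            by rw [e3, h'], fun i hi => ?_⟩⟩).mono ?_ ?_
        · rw [hf _ (by omega) (by omega) (by omega), hz i hi]
          simp only [List.exists_mem_cons_iff]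
          tauto
        · refine Nat.add_le_add (Nat.mul_le_mul ?_ (by decide)) hcost
          omega
        · rintro m' ⟨hf', ⟨-, -, hG⟩ | ⟨_, _, h0, -⟩⟩
          · exact ⟨env m' hf', Or.inr ⟨z, hz', r, hr.accepts.1, hr.accepts.2, by omega, hG⟩⟩
          · omega
    · have : (setVar 8 (.mul (var 1) (var 1))).cost + load.cost ≤ 50 := by decide
      omega
  · rintro m' ⟨-, ⟨-, h5, -⟩ | ⟨T, r, h, -⟩⟩
    · simp only [Test.Safe, Test.eval, Expr.Safe, Expr.eval, var, Nat.reduceMul, h5]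
      omega
    · omega
  · rintro k m' ⟨hf, ⟨h, -⟩ | ⟨T, r, hk, h1, h2, hr, h5, h6, hG⟩⟩
    · omega
    have h8 : m' 8 = N := by rw [hf _ (by omega) (by omega) (by omega) (by omega), hm.N_eq]
    have ho1 : m' (8 * T.1 + 3) = o T.1 := by
      rw [hf _ (by omega) (by omega) (by omega) (by omega), hm.item_eq _ h1]
    have ho2 : m' (8 * T.2 + 3) = o T.2 := by
      rw [hf _ (by omega) (by omega) (by omega) (by omega), hm.item_eq _ h2]
    have l1 := ho.lt T.1 (by omega)
    have l2 := ho.lt T.2 (by omega)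
    have hlt := num_lt h1 h2
    refine ⟨?_, ?_, wp_seq (wp_assign ?_ ?_ (wp_seq (wp_assign ?_ ?_ (wp_seq (wp_setVar
      (v := num N T) (by omega) ?_ ?_ fun m1 e1 f1 => ?_)))))⟩
    · simp only [Test.Safe, Expr.Safe, Expr.eval, var, Nat.reduceMul, h5]
      omega
    · simp only [Test.eval, Expr.eval, var, Nat.reduceMul, h5]
      omega
    all_goals
      try simp (disch := omega) only [Expr.eval, outBase, item, addr, var, Function.update_of_ne,
        h8, h5, h6, ho1, ho2, Nat.reduceMul, Nat.add_sub_cancel] at f1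
    all_goals
      try simp (disch := omega) only [Expr.Safe, Expr.eval, outBase, item, addr, var,
        Function.update_of_ne, h8, h5, h6, ho1, ho2, Nat.reduceMul, Nat.add_sub_cancel]
    any_goals omega
    · unfold num at hlt
      omega
    · rfl
    have g : ∀ a < 8 * (N * N) + 200, a ≠ 40 → a ≠ 48 → a ≠ 64 → m1 a = m a := by
      intro a a1 a2 a3 a4
      rw [f1 a a4]
      simp (disch := omega) only [Function.update_of_ne]
      exact hf a a1 a2 a3 a4
    have mark : ∀ i < n, m1 (8 * (N * N) + 200 + i) ≠ 0 ↔
        m' (8 * (N * N) + 200 + i) ≠ 0 ∨ o T.1 = i ∨ o T.2 = i := by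
      intro i hi
      rw [f1 _ (by omega)]
      simp only [Function.update_apply]
      by_cases c1 : o T.1 = i
      · simp [c1]
      · by_cases c2 : o T.2 = i
        · simp [c2]
        · rw [if_neg (by omega), if_neg (by omega)]
          simp [c1, c2]
    have t2 := g (8 * num N T + 2) (by omega) (by omega) (by omega) (by omega)
    have t4 := g (8 * num N T + 4) (by omega) (by omega) (by omega) (by omega)
    cases r with
    | nil =>
      refine wp_load hM e1 hlt.le (by rw [t2, hr.1]; omega) (by rw [t4, hr.2]; omega)
        fun m2 e2 e3 f2 => ⟨fun a a1 a2 a3 a4 => (f2 a a2 a3).trans (g a a1 a2 a3 a4),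
          Or.inl ⟨by simpa using hk, by rw [e2, t2, hr.1], fun i hi => ?_⟩⟩
      rw [f2 _ (by omega) (by omega), mark i hi, ← hG i hi]
      simp
    | cons w r =>
      obtain ⟨hw, hok, hr2, hr4, hr⟩ := hr
      obtain ⟨h3, h4, -⟩ := num_upd ho hN h1 h2 hw hok
      refine wp_load hM e1 hlt.le (by rw [t2, hr2]; omega) (by rw [t4, hr4]; omega)
        fun m2 e2 e3 f2 => ⟨fun a a1 a2 a3 a4 => (f2 a a2 a3).trans (g a a1 a2 a3 a4),
          Or.inr ⟨upd T w, r, by simpa using hk, h3, h4, hr, by rw [e2, t2, hr2],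
            by rw [e3, t4, hr4], fun i hi => ?_⟩⟩
      rw [f2 _ (by omega) (by omega), mark i hi, ← hG i hi]
      simp only [List.exists_mem_cons_iff]
      unfold upd
      -- One item of the new state is that of `w` and the other one belonged to `T`, so marking both
      -- items of a state adds no foreign point.
      split_ifs <;> simp only <;> tauto

/-! ### The whole program and its resource bounds -/

theorem wp_program (hp : GeneralPosition p) (hN : N = 2 * n) (hM : 8 * (N * N) + n + 300 ≤ M)
    {m : ℕ → ℕ} (h0 : m 0 = n) :
    WP p M program (100000 * (n + 1) ^ 3) m fun m' => m' 0 + n ≤ M ∧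
      ∀ S : Set (ℝ × ℝ), S ⊆ Set.range p →
        boundaryCount (Set.range p) S ≤ boundaryCount (Set.range p) (output p m') := by
  have hNM : N ≤ N * N := Nat.le_mul_self N
  refine WP.mono (wp_seq ((wp_sortLoop hp hN hM h0).mono le_rfl fun m1 ⟨o, ho, hm1⟩ =>
    wp_seq ((wp_stateLoop ho hN hM hm1).mono le_rfl fun m2 ⟨hm2, hD2⟩ =>
    wp_seq ((wp_firstLoop ho hN hM hm2 hD2).mono le_rfl fun m3 ⟨hm3, hD3, hE3⟩ =>
    wp_seq ((wp_clearLoop hM hm3).mono le_rfl fun m4 ⟨hf4, hz4⟩ => wp_seq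
    (t := (N * N + 1) * 200) (u := (setVar 0 outBase).cost) ?_))))) ?_ fun _ h => h
  · have hm4 : Env n N o m4 := hm3.congr (hf4 _ (by omega) (by omega))
      (hf4 _ (by omega) (by omega)) fun i hi => hf4 _ (by omega) (by omega)
    have hlt : ∀ z < n, num N (z, z) < N * N := fun z hz =>
      num_lt (by simp only; omega) (by simp only; omega)
    have hD4 : Done n N (fun U => pt p (o U)) m4 0 :=
      hD3.congr ho hN fun a _ ha ha' => hf4 _ (by omega) (by omega)
    have hE4 : Entry N m4 (N * N) {T | ∃ z < n, T = (z, z)} := by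
      refine hE3.congr (hf4 _ (by omega) (by omega)) (hf4 _ (by omega) (by omega))
        (hf4 _ (by omega) (by omega)) ?_
      rintro _ ⟨z, hz, rfl⟩
      have := hlt z hz
      exact hf4 _ (by omega) (by omega)
    refine (wp_walkLoop ho hN hM hm4 hD4 hE4 hz4).mono le_rfl fun m5 ⟨hm5, h5⟩ => ?_
    have h8 := hm5.N_eq
    refine wp_setVar (v := 8 * (N * N) + 200) (by omega) ?_ ?_ fun m6 e6 f6 => ?_
    · simp only [outBase, Expr.Safe, Expr.eval, var, Nat.reduceMul, h8]
      omega
    · simp only [outBase, Expr.eval, var, Nat.reduceMul, h8]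
    have e6' : m6 0 = 8 * (N * N) + 200 := e6
    refine ⟨by omega, fun S hS => ?_⟩
    refine (boundaryCount_le (K := m4 (8 * (N * N) + 1)) hp ho (fun z hz r hlt hr => ?_) hS).trans
      ?_
    · have h1 := length_le_of_accepts ho hN hD4 (T := (z, z)) (by simp only; omega)
        (by simp only; omega) hr (hN ▸ hlt)
      have h2 := hE4.1 _ ⟨z, hz, rfl⟩
      omega
    -- A value 0 for the empty sequence makes the upper bound 0, so any output is optimal.
    · rcases h5 with h5 | ⟨z, hz, r, hr, hlt, hlen, hG⟩
      · rw [h5]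
        exact Nat.zero_le _
      · rw [hlen]
        refine (length_succ_le_boundaryCount hp ho hz (hN ▸ hlt) hr).trans (le_of_eq ?_)
        congr 1
        ext x
        simp only [output, Set.mem_ofPred_eq, Set.mem_image, e6']
        constructor
        · rintro ⟨w, hw, rfl⟩
          have hw2 : w.2 < 2 * n := by
            rcases List.mem_cons.1 hw with rfl | h
            · simp only
              omega
            · have := hlt w h
              omega
          have := ho.lt w.2 hw2
          refine ⟨⟨o w.2, this⟩, ?_, (pt_of_lt p this).symm⟩
          rw [f6 _ (by omega), hG _ this]
          exact ⟨w, hw, rfl⟩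
        · rintro ⟨i, hi, rfl⟩
          rw [f6 _ (by omega), hG _ i.2] at hi
          obtain ⟨w, hw, hwi⟩ := hi
          exact ⟨w, hw, by rw [hwi, pt_of_lt p i.2]⟩
  · have : (setVar 0 outBase).cost ≤ 100 := by decide
    subst hN
    -- The table phase dominates: `2 * n + 1 ≤ 2 * (n + 1)` turns it into `9600 * (n + 1) ^ 3`, and
    -- the rest fits easily into 100000.
    have h1 : (2 * n + 1) * ((2 * n + 1) * ((2 * n + 1) * 1200)) ≤
        (2 * (n + 1)) * ((2 * (n + 1)) * ((2 * (n + 1)) * 1200)) := by gcongr <;> omega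
    have h2 : n + 1 ≤ (n + 1) ^ 3 := Nat.le_self_pow (by omega) _
    have h3 : (n + 1) ^ 2 ≤ (n + 1) ^ 3 := Nat.pow_le_pow_right (by omega) (by omega)
    have h4 : 2 * n * (2 * n) + 1 ≤ 4 * (n + 1) ^ 2 := by nlinarith
    have h5 : (n + 1) * ((n + 1) * 300) = 300 * (n + 1) ^ 2 := by ring
    have h6 : (2 * (n + 1)) * ((2 * (n + 1)) * ((2 * (n + 1)) * 1200)) = 9600 * (n + 1) ^ 3 := by
      ring
    omega

end MaxRCH

theorem mainTheorem1 :
    ∃ (c : RAM.Prog) (T M : ℕ → ℕ),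
      (fun n => (T n : ℝ)) =O[Filter.atTop] (fun n => (n : ℝ) ^ 3) ∧
      (fun n => (M n : ℝ)) =O[Filter.atTop] (fun n => (n : ℝ) ^ 2) ∧
      c.SolvesMaxRCH T M := by
  refine ⟨MaxRCH.program, fun n => 100000 * (n + 1) ^ 3,
    fun n => 8 * (2 * n * (2 * n)) + n + 300, ?_, ?_, fun n p hp => ?_⟩
  · refine Asymptotics.IsBigO.of_bound 800000 ?_
    filter_upwards [Filter.eventually_ge_atTop 1] with n hn
    have h : 100000 * (n + 1) ^ 3 ≤ 800000 * n ^ 3 := by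
      have : (n + 1) ^ 3 ≤ (2 * n) ^ 3 := Nat.pow_le_pow_left (by omega) 3
      rw [Nat.mul_pow] at this
      omega
    simp only [Real.norm_natCast, norm_pow]
    exact_mod_cast h
  · refine Asymptotics.IsBigO.of_bound 333 ?_
    filter_upwards [Filter.eventually_ge_atTop 1] with n hn
    -- For `n ≥ 1` the terms are at most 32, 1 and 300 times `n ^ 2`.
    have h : 8 * (2 * n * (2 * n)) + n + 300 ≤ 333 * n ^ 2 := by nlinarith
    simp only [Real.norm_natCast, norm_pow]
    exact_mod_cast h
  · obtain ⟨t, ht, m, he, hm, hS⟩ := MaxRCH.wp_program hp rfl le_rfl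
      (m := RAM.initMem n) (by simp [RAM.initMem])
    exact ⟨t, m, ht, he, hm, hS⟩
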